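/- Let $T$ be an $n$-dimensional simplex in a Euclidean space with ordered, affinely independent vertices $v_0,\dots,v_n$, oriented by the order of its vertices, and let $\lambda_0,\dots,\lambda_n$ be its barycentric coordinates. Let $A(r,n)$ be the set of multiindices $\alpha:\{0,\dots,n\}\to\mathbb N_0$ with $|\alpha|=r$, and let $\Sigma(k,n)$ be the set of strictly ascending $k$-tuples $\sigma$ in $\{0,\dots,n\}$, with underlying set $[\sigma]$. For $p\in[\sigma]$ let $\sigma-p$ be the ascending tuple with underlying set $[\sigma]\setminus\{p\}$, for $q\notin[\sigma]$ let $\sigma+q$ be the one with $[\sigma]\cup\{q\}$, and let $\sigma^c$ be the one with $\{0,\dots,n\}\setminus[\sigma]$. For disjoint ascending tuples let $\epsilon(\sigma,\rho)$ be the sign of the permutation that sorts the concatenated sequence $\sigma,\rho$ (a number $p$ is read as a tuple of length one). Put $\lambda^\alpha=\prod_i\lambda_i^{\alpha(i)}$, $\lambda_\sigma=\prod_{i\in[\sigma]}\lambda_i$, $\mathrm d\lambda_\sigma=\mathrm d\lambda_{\sigma(1)}\wedge\dots\wedge\mathrm d\lambda_{\sigma(k)}$ (equal to $1$ for $k=0$),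 $\phi_\rho=\sum_{p\in[\rho]}\epsilon(p,\rho-p)\,\lambda_p\,\mathrm d\lambda_{\rho-p}$, and let $\phi_T=\phi_{(0,\dots,n)}$. Let $$\mathcal P_r\Lambda^k(T)=\operatorname{span}_{\mathbb C}\{\lambda^\alpha\,\mathrm d\lambda_\sigma:\alpha\in A(r,n),\ \sigma\in\Sigma(k,n)\},$$ $$\mathcal P^-_r\Lambda^k(T)=\operatorname{span}_{\mathbb C}\{\lambda^\alpha\phi_\rho:\alpha\in A(r-1,n),\ \rho\in\Sigma(k+1,n)\},$$ and let $\mathring{\mathcal P}^-_r\Lambda^k(T)$ be the subspace of those forms in $\mathcal P^-_r\Lambda^k(T)$ whose pullback to every proper subsimplex $F\subsetneq T$ vanishes. **Theorem.** Let $r\in\mathbb N_0$ and $0\le k\le n$. (1) For every family of complex numbers $\omega_{\alpha\sigma}$, indexed by $\alpha\in A(r,n)$ and $\sigma\in\Sigma(k,n)$, $$\sum_{\alpha,\beta\in A(r,n)}\ \sum_{\sigma,\rho\in\Sigma(k,n)}\int_T\omega_{\alpha\sigma}\lambda^\alpha\,\mathrm d\lambda_\sigma\wedge\epsilon(\rho,\rho^c)\,\overline{\omega_{\beta\rho}}\,\lambda^\beta\lambda_\rho\,\phi_{\rho^c}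 =(-1)^k\sum_{\theta\in\Sigma(k+1,n)}\int_T\lambda_\theta\,\Big|\sum_{\alpha\in A(r,n)}\sum_{p\in[\theta]}\epsilon(p,\theta-p)\,\lambda^\alpha\,\omega_{\alpha,\theta-p}\Big|^2\,\phi_T .$$ (2) The following are equivalent: (i) the quantity in (1) is zero; (ii) $\sum_{\alpha,\sigma}\omega_{\alpha\sigma}\lambda^\alpha\,\mathrm d\lambda_\sigma=0$ on $T$; (iii) $\sum_{\alpha,\sigma}\epsilon(\sigma,\sigma^c)\,\omega_{\alpha\sigma}\lambda^\alpha\lambda_\sigma\,\phi_{\sigma^c}=0$ on $T$; (iv) $\omega_{\alpha\sigma}-\sum_{p\in[\sigma]}\epsilon(p,\sigma-p)\,\omega_{\alpha,\sigma-p+0}=0$ for all $\alpha\in A(r,n)$ and all $\sigma\in\Sigma(k,n)$ with $0\notin[\sigma]$; (v) $\sum_{p\in[\theta]}\epsilon(p,\theta-p)\,\omega_{\alpha,\theta-p}=0$ for all $\alpha\in A(r,n)$ and all $\theta\in\Sigma(k+1,n)$. (3) The map $(\omega,\eta)\mapsto\int_T\omega\wedge\eta$ is a non-degenerate bilinear pairing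 between $\mathcal P_r\Lambda^k(T)$ and $\mathring{\mathcal P}^-_{r+k+1}\Lambda^{n-k}(T)$, that is, no nonzero element of either space pairs to zero with all of the other space. -/

import Mathlib

open scoped ComplexConjugate

noncomputable section

namespace BaryForms

/-! ### Combinatorics

An alternator index, i.e. a strictly ascending map into `[0:n]`, is encoded by its image, a
`Finset (Fin (n + 1))`. So `Σ(k,n)` consists of the finsets of cardinality `k`, `Σ₀(k,n)` of
those of cardinality `k + 1`, and `σ + q`, `σ - p`, `σᶜ` are `insert q σ`, `σ.erase p`, `σᶜ`. -/

/-- `Σ(k,n)`. -/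
abbrev altIndices (k n : ℕ) : Finset (Finset (Fin (n + 1))) :=
  Finset.powersetCard k Finset.univ

/-- `A(r,n)`: the multiindices `α : [0:n] → ℕ` with `|α| = r`. -/
abbrev multiIndices (r n : ℕ) : Finset (Fin (n + 1) → ℕ) :=
  Finset.piAntidiag Finset.univ r

/-- `ε(σ,ρ)` for disjoint `σ`, `ρ`: the sign of the permutation that sorts the concatenation of
the ascending enumerations of `σ` and `ρ`, i.e. `-1` to the number of pairs that are out of order.
-/
def eps {m : ℕ} (σ ρ : Finset (Fin m)) : ℂ :=
  ∏ a ∈ σ, ∏ b ∈ ρ, if a < b then 1 else -1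

/-! ### Exterior algebra -/

section Exterior

variable {V : Type*} [AddCommGroup V] [Module ℝ V]

/-- The exterior product of complex-valued alternating forms, normalized so that
`(f ∧ g) (u, v) = f u * g v - f v * g u` for one-forms `f`, `g`. -/
def wedge {k l : ℕ} (a : V [⋀^Fin k]→ₗ[ℝ] ℂ) (b : V [⋀^Fin l]→ₗ[ℝ] ℂ) :
    V [⋀^Fin (k + l)]→ₗ[ℝ] ℂ :=
  ((LinearMap.mul' ℝ ℂ).compAlternatingMap (a.domCoprod b)).domDomCongr finSumFinEquiv

/-- The exterior product `f₀ ∧ ⋯ ∧ fₖ₋₁` of one-forms, `v ↦ det (fᵢ (vⱼ))`; it is `1` for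
`k = 0`. -/
def wedgeOne {k : ℕ} (f : Fin k → V →ₗ[ℝ] ℂ) : V [⋀^Fin k]→ₗ[ℝ] ℂ :=
  MultilinearMap.alternatization ((MultilinearMap.mkPiAlgebra ℝ (Fin k) ℂ).compLinearMap f)

theorem wedgeOne_apply {k : ℕ} (f : Fin k → V →ₗ[ℝ] ℂ) (v : Fin k → V) :
    wedgeOne f v = Matrix.det (Matrix.of fun i j => f i (v j)) := by
  rw [← Matrix.det_transpose, Matrix.det_apply]
  simp [wedgeOne, MultilinearMap.alternatization_apply]

/-- `wedgeOne` is the iterated `wedge`. -/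
theorem wedge_wedgeOne {k l : ℕ} (f : Fin k → V →ₗ[ℝ] ℂ) (g : Fin l → V →ₗ[ℝ] ℂ) :
    wedge (wedgeOne f) (wedgeOne g) = wedgeOne (Fin.append f g) := by
  unfold wedge wedgeOne
  rw [← MultilinearMap.domCoprod_alternization]
  ext v
  simp only [AlternatingMap.domDomCongr_apply, LinearMap.compAlternatingMap_apply,
    MultilinearMap.alternatization_apply, map_sum]
  refine Fintype.sum_equiv (Equiv.permCongr finSumFinEquiv) _ _ fun τ => ?_
  simp [Fin.prod_univ_add, Equiv.Perm.sign_permCongr, Equiv.permCongr_apply]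

end Exterior

/-! ### Simplices -/

variable {E : Type*} [NormedAddCommGroup E] [InnerProductSpace ℝ E] {n : ℕ}

/-- The simplex as a set of points: the convex closure of its vertices. -/
abbrev body (T : Affine.Simplex ℝ E n) : Set E :=
  convexHull ℝ (Set.range T.points)

/-- The tangent space of the simplex. -/
abbrev tangent (T : Affine.Simplex ℝ E n) : Submodule ℝ E :=
  (affineSpan ℝ (Set.range T.points)).direction

/-- The vertices of the simplex as an affine basis of the affine space that they span. -/
def vertexBasis (T : Affine.Simplex ℝ E n) :
    AffineBasis (Fin (n + 1)) ℝ (affineSpan ℝ (Set.range T.points)) where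
  toFun := (T.restrict _ le_rfl).points
  ind' := (T.restrict _ le_rfl).independent
  tot' := by
    have h := affineSpan_coe_preimage_eq_top (k := ℝ) (Set.range T.points)
    convert h using 2
    ext x
    simp [Subtype.ext_iff]

/-- The barycentric coordinate `λᵢ`, as an affine function on the affine span of the simplex. -/
def baryAffine (T : Affine.Simplex ℝ E n) (i : Fin (n + 1)) :
    affineSpan ℝ (Set.range T.points) →ᵃ[ℝ] ℝ :=
  (vertexBasis T).coord i

/-- The barycentric coordinate `λᵢ`, as a function on the simplex. -/
def lam (T : Affine.Simplex ℝ E n) (i : Fin (n + 1)) (x : body T) : ℂ :=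
  (baryAffine T i ⟨x, convexHull_subset_affineSpan _ x.2⟩ : ℝ)

/-- The differential of `λᵢ`: since `λᵢ` is affine, this is its linear part, at every point. -/
def dlamOne (T : Affine.Simplex ℝ E n) (i : Fin (n + 1)) : tangent T →ₗ[ℝ] ℂ :=
  Complex.ofRealAm.toLinearMap ∘ₗ (baryAffine T i).linear

/-- Complex-valued fields of alternating `k`-forms on the tangent space of the simplex. -/
abbrev DForm (T : Affine.Simplex ℝ E n) (k : ℕ) : Type _ :=
  body T → (tangent T) [⋀^Fin k]→ₗ[ℝ] ℂ

/-- The exterior product of differential forms. -/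
def DForm.wedge {T : Affine.Simplex ℝ E n} {k l : ℕ} (ω : DForm T k) (η : DForm T l) :
    DForm T (k + l) :=
  fun x => BaryForms.wedge (ω x) (η x)

/-- The barycentric polynomial `λ^α`. -/
def lamPow (T : Affine.Simplex ℝ E n) (α : Fin (n + 1) → ℕ) (x : body T) : ℂ :=
  ∏ i, lam T i x ^ α i

/-- The product `λ_σ` of the `λᵢ` with `i ∈ [σ]`. -/
def lamProd (T : Affine.Simplex ℝ E n) (σ : Finset (Fin (n + 1))) (x : body T) : ℂ :=
  ∏ i ∈ σ, lam T i x

/-- The barycentric alternator `dλ_σ = dλ_{σ(1)} ∧ ⋯ ∧ dλ_{σ(k)}` for `σ` of cardinality `k`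
(and `0`, by convention, for `σ` of any other cardinality). -/
def dlam (T : Affine.Simplex ℝ E n) (k : ℕ) (σ : Finset (Fin (n + 1))) : DForm T k :=
  fun _ => if h : σ.card = k then wedgeOne fun i => dlamOne T (σ.orderEmbOfFin h i) else 0

/-- The Whitney `k`-form `φ_ρ = ∑_{p ∈ [ρ]} ε(p,ρ-p) λ_p dλ_{ρ-p}` for `ρ` of cardinality
`k + 1`. -/
def whitney (T : Affine.Simplex ℝ E n) (k : ℕ) (ρ : Finset (Fin (n + 1))) : DForm T k :=
  fun x => ∑ p ∈ ρ, (eps {p} (ρ.erase p) * lam T p x) • dlam T k (ρ.erase p) x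

/-- The volume form `φ_T`, the Whitney form of all the vertices. -/
def whitneyTop (T : Affine.Simplex ℝ E n) : DForm T n :=
  whitney T n Finset.univ

/-! ### Integration

The integral of an `n`-form is the integral of its pullback to the reference simplex in `ℝⁿ`
under the affine parametrization that respects the order of the vertices. -/

/-- The reference simplex in `ℝⁿ`. -/
def refSimplex (n : ℕ) : Set (Fin n → ℝ) :=
  {y | (∀ i, 0 ≤ y i) ∧ ∑ i, y i ≤ 1}

/-- The affine parametrization of the simplex by the reference simplex. -/
def param (T : Affine.Simplex ℝ E n) (y : refSimplex n) : body T :=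
  ⟨T.points 0 + ∑ i : Fin n, y.1 i • (T.points i.succ - T.points 0), by
    obtain ⟨y, h0, h1⟩ := y
    have h := (convex_convexHull ℝ (Set.range T.points)).sum_mem
      (t := Finset.univ) (w := Fin.cons (1 - ∑ i, y i) y) (z := T.points)
      (fun i _ => by
        refine Fin.cases ?_ (fun j => ?_) i
        · simpa using h1
        · simpa using h0 j)
      (by simp [Fin.sum_univ_succ])
      (fun i _ => subset_convexHull ℝ _ (Set.mem_range_self i))
    convert h using 1
    simp only [Fin.sum_univ_succ, Fin.cons_zero, Fin.cons_succ, smul_sub, sub_smul, one_smul,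
      Finset.sum_sub_distrib, Finset.sum_smul]
    abel⟩

/-- The edge vectors `v_{j+1} - v_0`, the partial derivatives of the parametrization. -/
def edge (T : Affine.Simplex ℝ E n) (j : Fin n) : tangent T :=
  ⟨T.points j.succ - T.points 0, AffineSubspace.vsub_mem_direction
    (mem_affineSpan ℝ (Set.mem_range_self _)) (mem_affineSpan ℝ (Set.mem_range_self _))⟩

/-- The integral over the simplex, oriented by the order of its vertices, of a differential form
whose degree `m` is the dimension of the simplex. -/
def integral (T : Affine.Simplex ℝ E n) {m : ℕ} (h : m = n) (ω : DForm T m) : ℂ :=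
  ∫ y : refSimplex n, ω (param T y) (fun j => edge T (Fin.cast h j))
    ∂(MeasureTheory.Measure.comap Subtype.val MeasureTheory.volume)

/-! ### Traces and finite element spaces -/

/-- The trace of a form onto a subsimplex, i.e. the pullback under the inclusion. -/
def trace (T : Affine.Simplex ℝ E n) {k m : ℕ} {fs : Finset (Fin (n + 1))} (h : fs.card = m + 1)
    (ω : DForm T k) : DForm (T.face h) k :=
  fun x => (ω ⟨x, convexHull_mono
      (by rw [Affine.Simplex.range_face_points]; exact Set.image_subset_range _ _) x.2⟩).compLinearMap
    (Submodule.inclusion (AffineSubspace.direction_le (T.affineSpan_face_le h)))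

/-- `P_r Λ^k(T)`. -/
def PLam (T : Affine.Simplex ℝ E n) (r k : ℕ) : Submodule ℂ (DForm T k) :=
  Submodule.span ℂ {ω | ∃ α : Fin (n + 1) → ℕ, ∃ σ : Finset (Fin (n + 1)),
    ∑ i, α i = r ∧ σ.card = k ∧ ω = fun x => lamPow T α x • dlam T k σ x}

/-- `P_r^- Λ^k(T)`; the multiindices have degree `r - 1`, so that the space is trivial for
`r = 0`. -/
def PMinusLam (T : Affine.Simplex ℝ E n) (r k : ℕ) : Submodule ℂ (DForm T k) :=
  Submodule.span ℂ {ω | ∃ α : Fin (n + 1) → ℕ, ∃ ρ : Finset (Fin (n + 1)),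
    ∑ i, α i + 1 = r ∧ ρ.card = k + 1 ∧ ω = fun x => lamPow T α x • whitney T k ρ x}

/-- The subspace of `P_r^- Λ^k(T)` of the forms whose traces onto all proper subsimplices
vanish. -/
def PMinusLamZero (T : Affine.Simplex ℝ E n) (r k : ℕ) : Submodule ℂ (DForm T k) where
  carrier := {ω | ω ∈ PMinusLam T r k ∧
    ∀ (m : ℕ) (fs : Finset (Fin (n + 1))) (h : fs.card = m + 1), fs ≠ Finset.univ →
      trace T h ω = 0}
  add_mem' := by
    rintro a b ⟨ha, ha'⟩ ⟨hb, hb'⟩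
    refine ⟨add_mem ha hb, fun m fs h hfs => ?_⟩
    funext x
    have h1 := congrFun (ha' m fs h hfs) x
    have h2 := congrFun (hb' m fs h hfs) x
    simp only [trace, Pi.zero_apply] at h1 h2 ⊢
    rw [Pi.add_apply, AlternatingMap.add_compLinearMap, h1, h2, add_zero]
  zero_mem' := ⟨zero_mem _, fun m fs h _ => by
    funext x
    simp [trace]⟩
  smul_mem' := by
    rintro c a ⟨ha, ha'⟩
    refine ⟨Submodule.smul_mem _ c ha, fun m fs h hfs => ?_⟩
    funext x
    have h1 := congrFun (ha' m fs h hfs) x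
    simp only [trace, Pi.zero_apply] at h1 ⊢
    ext v
    have h2 := DFunLike.congr_fun h1 v
    simp only [AlternatingMap.compLinearMap_apply, AlternatingMap.zero_apply] at h2
    simp [h2]

/-- The sesquilinear expression
`∑_{α,β} ∑_{σ,ρ} ∫_T ω_{ασ} λ^α dλ_σ ∧ ε(ρ,ρᶜ) conj(ω_{βρ}) λ^β λ_ρ φ_{ρᶜ}`. -/
def pairingSum (T : Affine.Simplex ℝ E n) (r k : ℕ) (hk : k ≤ n)
    (ω : (Fin (n + 1) → ℕ) → Finset (Fin (n + 1)) → ℂ) : ℂ :=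
  ∑ α ∈ multiIndices r n, ∑ β ∈ multiIndices r n,
    ∑ σ ∈ altIndices k n, ∑ ρ ∈ altIndices k n,
      integral T (Nat.add_sub_of_le hk)
        (DForm.wedge (fun x => (ω α σ * lamPow T α x) • dlam T k σ x)
          (fun x => (eps ρ ρᶜ * conj (ω β ρ) * lamPow T β x * lamProd T ρ x) •
            whitney T (n - k) ρᶜ x))

end BaryForms

end

open BaryForms

open scoped ComplexConjugate

noncomputable section

namespace BaryForms

/-! ### Signs -/

section Signs

variable {m : ℕ}

/-! Write `D` for the alternating difference `altD` of a coefficient family and `c_σ = ∑_α ω_{ασ}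
λ^α`. Expanding the Whitney forms in `∑_σ ε(σ,σᶜ) b_σ λ_σ φ_{σᶜ}` and collecting by `θ = σ + q`
gives `(-1)^k ∑_θ ε(θ,θᶜ) λ_θ (Db)_θ dλ_{θᶜ}` (`sum_whitney_compl`). Wedging `∑_σ c_σ dλ_σ` with
`dλ_{θᶜ}` leaves only `σ = θ - p` and returns `ε(θ,θᶜ) (Dc)_θ` times the volume form
(`sum_mul_wedge_dlam_compl`). The wedge product is therefore `(-1)^k ∑_θ λ_θ (Dc)_θ (Db)_θ φ_T` at
every point, and `b = conj c` gives (1).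

In (2) everything passes through `Dω_α = 0`, which is (v). If the integral is zero, the weights `λ_θ
> 0` force `Dc = 0` on the interior; its components are homogeneous polynomials, hence zero, so (v)
holds. Conversely a `D`-closed family is itself a difference (cone over vertex `0`), so the form
vanishes because `∑ dλ_i = 0`; the dual form vanishes because only `Db` enters it.

For (3), a form is tested against the partner with conjugate coefficients. This requires that every
form in the zero-trace space is a dual form (`exists_eq_dualFormOf`). Such a form is `∑ g_τ dλ_τ`
with `g = Kf`, where `K` is the Koszul contraction `altK`, so `Kg = 0`. The zero traces and the
homotopy formula `KD + DK = ∑ λ_p = 1` make `g_τ` vanish on each facet `λ_i = 0` with `i ∉ τ`; hence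
`λ_{τᶜ}` divides `g_τ`. By `Kg = 0` the quotients form a cocycle, and coning over vertex `0`
(`altD_cone`) writes them as a difference, which supplies the coefficients. -/

theorem eps_insert_left {p : Fin m} {σ : Finset (Fin m)} (ρ : Finset (Fin m)) (h : p ∉ σ) :
    eps (insert p σ) ρ = eps {p} ρ * eps σ ρ := by
  simp [eps, Finset.prod_insert h]

theorem eps_insert_right (σ : Finset (Fin m)) {q : Fin m} {ρ : Finset (Fin m)} (h : q ∉ ρ) :
    eps σ (insert q ρ) = eps σ {q} * eps σ ρ := by
  simp only [eps, Finset.prod_insert h, Finset.prod_mul_distrib, Finset.prod_singleton]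

theorem eps_mul_self (σ ρ : Finset (Fin m)) : eps σ ρ * eps σ ρ = 1 := by
  simp only [eps, ← Finset.prod_mul_distrib]
  refine Finset.prod_eq_one fun a _ => Finset.prod_eq_one fun b _ => ?_
  split_ifs <;> simp

theorem eps_ne_zero (σ ρ : Finset (Fin m)) : eps σ ρ ≠ 0 :=
  left_ne_zero_of_mul_eq_one (eps_mul_self σ ρ)

theorem eps_singleton_swap {p q : Fin m} (h : p ≠ q) :
    eps {p} {q} = -eps {q} {p} := by
  rcases lt_or_gt_of_ne h with h | h <;> simp [eps, h, h.not_gt]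

theorem eps_singleton_right {p : Fin m} {σ : Finset (Fin m)} (h : p ∉ σ) :
    eps σ {p} = (-1) ^ σ.card * eps {p} σ := by
  simp only [eps, Finset.prod_singleton]
  rw [← Finset.prod_const, ← Finset.prod_mul_distrib]
  refine Finset.prod_congr rfl fun a ha => ?_
  have hne : a ≠ p := fun e => h (e ▸ ha)
  rcases lt_or_gt_of_ne hne with h | h <;> simp [h, h.not_gt]

theorem eps_zero_left {m : ℕ} {σ : Finset (Fin (m + 1))} (h : 0 ∉ σ) : eps {0} σ = 1 := by
  simp only [eps, Finset.prod_singleton]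
  refine Finset.prod_eq_one fun a ha => if_pos (Fin.pos_of_ne_zero fun e => h (e ▸ ha))

theorem conj_eps (σ ρ : Finset (Fin m)) : (starRingEnd ℂ) (eps σ ρ) = eps σ ρ := by
  simp only [eps, map_prod]
  refine Finset.prod_congr rfl fun a _ => Finset.prod_congr rfl fun b _ => ?_
  split_ifs <;> simp

/-- Exchanging the order in which two indices are split off an ascending tuple. -/
theorem eps_insert_mul_eps_swap {p q : Fin m} {μ : Finset (Fin m)} (hpq : p ≠ q) (hp : p ∉ μ)
    (hq : q ∉ μ) :
    eps {p} (insert q μ) * eps {q} μ = -(eps {q} (insert p μ) * eps {p} μ) := by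
  rw [eps_insert_right _ hq, eps_insert_right _ hp, eps_singleton_swap hpq]
  ring

/-- The sign that relates `λ_σ φ_{σᶜ}` to `λ_θ dλ_{θᶜ}` for `σ = θ - p`. -/
theorem eps_erase_compl {p : Fin m} {θ : Finset (Fin m)} (hp : p ∈ θ) :
    eps (θ.erase p) (θ.erase p)ᶜ * eps {p} θᶜ
      = (-1) ^ (θ.card - 1) * eps θ θᶜ * eps {p} (θ.erase p) := by
  have h1 : (θ.erase p)ᶜ = insert p θᶜ := by
    rw [Finset.compl_erase]
  have h2 : eps θ θᶜ = eps {p} θᶜ * eps (θ.erase p) θᶜ := by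
    rw [← eps_insert_left _ (Finset.notMem_erase p θ), Finset.insert_erase hp]
  rw [h1, eps_insert_right _ (by simpa using hp), h2,
    eps_singleton_right (Finset.notMem_erase p θ), Finset.card_erase_of_mem hp]
  ring

end Signs

/-! ### Reindexing -/

section Reindex

variable {N : ℕ} {A : Type*} [AddCommMonoid A]

theorem sum_powersetCard_eq_sum_erase {k : ℕ} {θ : Finset (Fin N)} (hθ : θ.card = k + 1)
    (F : Finset (Fin N) → A) :
    ∑ σ ∈ Finset.powersetCard k θ, F σ = ∑ p ∈ θ, F (θ.erase p) := by
  symm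
  refine Finset.sum_bij (fun p _ => θ.erase p) ?_ ?_ ?_ fun _ _ => rfl
  · intro p hp
    rw [Finset.mem_powersetCard, Finset.card_erase_of_mem hp, hθ]
    exact ⟨Finset.erase_subset _ _, rfl⟩
  · intro p hp q hq h
    exact Finset.erase_injOn θ hp hq h
  · intro σ hσ
    rw [Finset.mem_powersetCard] at hσ
    obtain ⟨p, hp, rfl⟩ : ∃ p ∈ θ, θ.erase p = σ := by
      have : σ ⋖ θ := by
        rw [Finset.covBy_iff_card_sdiff_eq_one]
        refine ⟨hσ.1, ?_⟩
        rw [Finset.card_sdiff_of_subset hσ.1, hθ, hσ.2]; omega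
      rw [Finset.covBy_iff_exists_erase] at this
      obtain ⟨a, ha, h⟩ := this
      exact ⟨a, ha, h⟩
    exact ⟨p, hp, rfl⟩

theorem sum_compl_eq_sum_erase (k : ℕ) (F : Finset (Fin N) → Fin N → A) :
    ∑ σ ∈ Finset.powersetCard k Finset.univ, ∑ q ∈ σᶜ, F σ q
      = ∑ θ ∈ Finset.powersetCard (k + 1) Finset.univ, ∑ p ∈ θ, F (θ.erase p) p := by
  rw [Finset.sum_sigma', Finset.sum_sigma']
  refine Finset.sum_bij' (fun x _ => ⟨insert x.2 x.1, x.2⟩) (fun x _ => ⟨x.1.erase x.2, x.2⟩)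
    ?_ ?_ ?_ ?_ ?_
  · rintro ⟨σ, q⟩ h
    simp only [Finset.mem_sigma, Finset.mem_powersetCard_univ, Finset.mem_compl] at h ⊢
    exact ⟨by rw [Finset.card_insert_of_notMem h.2, h.1], Finset.mem_insert_self _ _⟩
  · rintro ⟨σ, q⟩ h
    simp only [Finset.mem_sigma, Finset.mem_powersetCard_univ, Finset.mem_compl] at h ⊢
    exact ⟨by rw [Finset.card_erase_of_mem h.2, h.1]; rfl, Finset.notMem_erase _ _⟩
  · rintro ⟨σ, q⟩ h
    simp only [Finset.mem_sigma, Finset.mem_powersetCard_univ, Finset.mem_compl] at h ⊢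
    rw [Finset.erase_insert h.2]
  · rintro ⟨σ, q⟩ h
    simp only [Finset.mem_sigma, Finset.mem_powersetCard_univ] at h ⊢
    rw [Finset.insert_erase h.2]
  · rintro ⟨σ, q⟩ h
    simp only [Finset.mem_sigma, Finset.mem_powersetCard_univ, Finset.mem_compl] at h ⊢
    rw [Finset.erase_insert h.2]

theorem sum_powersetCard_compl {k l : ℕ} (h : k + l = N) (F : Finset (Fin N) → A) :
    ∑ σ ∈ Finset.powersetCard l Finset.univ, F σ
      = ∑ θ ∈ Finset.powersetCard k Finset.univ, F θᶜ := by
  refine Finset.sum_bij' (fun s _ => sᶜ) (fun s _ => sᶜ) ?_ ?_ ?_ ?_ ?_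
  · intro s hs
    rw [Finset.mem_powersetCard_univ] at hs ⊢
    rw [Finset.card_compl, hs, Fintype.card_fin]; omega
  · intro s hs
    rw [Finset.mem_powersetCard_univ] at hs ⊢
    rw [Finset.card_compl, hs, Fintype.card_fin]; omega
  all_goals simp

end Reindex

/-- Exchanging the two summations turns the sum into its own negative. This is the cancellation
behind both `K² = 0` and `D² = 0`. -/
theorem sum_sum_erase_eq_zero {ι A : Type*} [DecidableEq ι] [AddCommGroup A] [Module ℂ A]
    (s : Finset ι) (F : ι → ι → A) (hF : ∀ p ∈ s, ∀ q ∈ s, p ≠ q → F p q = -F q p) :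
    ∑ p ∈ s, ∑ q ∈ s.erase p, F p q = 0 := by
  have h : ∑ p ∈ s, ∑ q ∈ s.erase p, F p q = ∑ q ∈ s, ∑ p ∈ s.erase q, F p q :=
    Finset.sum_comm' (by intro x y; simp only [Finset.mem_erase]; tauto)
  have : IsAddTorsionFree A := .of_isTorsionFree ℂ A
  rw [← self_eq_neg]
  nth_rewrite 1 [h]
  simp only [← Finset.sum_neg_distrib]
  refine Finset.sum_congr rfl fun p hp => Finset.sum_congr rfl fun q hq => ?_
  rw [Finset.mem_erase] at hq
  exact hF q hq.2 p hp hq.1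

/-! ### The alternating difference and the Koszul operator on coefficient families -/

section Complex

variable {N : ℕ} {A : Type*} [CommRing A] [Algebra ℂ A]

/-- The coefficients of `(∑ᵢ dλᵢ) ∧ ∑_σ b_σ dλ_σ`. -/
def altD (b : Finset (Fin N) → A) (θ : Finset (Fin N)) : A :=
  ∑ p ∈ θ, eps {p} (θ.erase p) • b (θ.erase p)

/-- The coefficients of the contraction of `∑_σ g_σ dλ_σ` with the vector `t`. -/
def altK (t : Fin N → A) (g : Finset (Fin N) → A) (μ : Finset (Fin N)) : A :=
  ∑ p ∈ μᶜ, eps {p} μ • (t p * g (insert p μ))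

/-- Two contractions insert two indices one after the other; exchanging their order flips the sign
and leaves the rest of the term unchanged. -/
theorem altK_altK (t : Fin N → A) (f : Finset (Fin N) → A) (μ : Finset (Fin N)) :
    altK t (altK t f) μ = 0 := by
  have h : altK t (altK t f) μ = ∑ p ∈ μᶜ, ∑ q ∈ μᶜ.erase p,
      (eps {q} (insert p μ) * eps {p} μ) • (t p * t q * f (insert q (insert p μ))) := by
    unfold altK
    refine Finset.sum_congr rfl fun p hp => ?_
    rw [Finset.compl_insert, Finset.mul_sum, Finset.smul_sum]
    refine Finset.sum_congr rfl fun q hq => ?_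
    rw [mul_smul_comm, smul_smul, mul_comm (eps {p} μ), mul_assoc]
  rw [h]
  refine sum_sum_erase_eq_zero _ _ fun p hp q hq hpq => ?_
  rw [Finset.mem_compl] at hp hq
  rw [eps_insert_mul_eps_swap hpq.symm hq hp, Finset.insert_comm q p, mul_comm (t p), neg_smul]

/-- The homotopy formula `D K + K D = ∑ₚ tₚ`. -/
theorem altK_altD_add_altD_altK (t : Fin N → A) (g : Finset (Fin N) → A) (τ : Finset (Fin N)) :
    altK t (altD g) τ + altD (altK t g) τ = (∑ p, t p) * g τ := by
  -- The first sum collects the terms in which the inserted index is removed again. In `h2` it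
  -- collects those in which the removed index is put back; together these run over all `p`.
  have h1 : altK t (altD g) τ = ∑ p ∈ τᶜ, t p * g τ + ∑ p ∈ τᶜ, ∑ q ∈ τ,
      (eps {q} ((insert p τ).erase q) * eps {p} τ) • (t p * g ((insert p τ).erase q)) := by
    rw [← Finset.sum_add_distrib]
    unfold altK altD
    refine Finset.sum_congr rfl fun p hp => ?_
    rw [Finset.mem_compl] at hp
    rw [Finset.sum_insert hp, Finset.erase_insert hp, mul_add, smul_add, mul_smul_comm, smul_smul,
      eps_mul_self, one_smul, Finset.mul_sum, Finset.smul_sum]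
    congr 1
    refine Finset.sum_congr rfl fun q hq => ?_
    rw [mul_smul_comm, smul_smul, mul_comm (eps {p} τ)]
  have h2 : altD (altK t g) τ = ∑ p ∈ τ, t p * g τ + ∑ p ∈ τᶜ, ∑ q ∈ τ,
      (eps {q} (τ.erase q) * eps {p} (τ.erase q)) • (t p * g (insert p (τ.erase q))) := by
    rw [Finset.sum_comm, ← Finset.sum_add_distrib]
    unfold altD
    refine Finset.sum_congr rfl fun q hq => ?_
    rw [altK, Finset.compl_erase, Finset.sum_insert (by simpa using hq), smul_add, smul_smul,
      eps_mul_self, one_smul, Finset.insert_erase hq, Finset.smul_sum]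
    congr 1
    refine Finset.sum_congr rfl fun p hp => ?_
    rw [smul_smul]
  -- The mixed terms replace `q ∈ τ` by `p ∉ τ`. The two orders of doing so differ by `ε(p,q) =
  -- -ε(q,p)`, so they cancel.
  have h3 : ∀ p ∈ τᶜ, ∀ q ∈ τ,
      (eps {q} ((insert p τ).erase q) * eps {p} τ) • (t p * g ((insert p τ).erase q))
        = -((eps {q} (τ.erase q) * eps {p} (τ.erase q)) • (t p * g (insert p (τ.erase q)))) := by
    intro p hp q hq
    rw [Finset.mem_compl] at hp
    have hpq : p ≠ q := fun e => hp (e ▸ hq)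
    have he : (insert p τ).erase q = insert p (τ.erase q) :=
      Finset.erase_insert_of_ne hpq
    have hp' : p ∉ τ.erase q := fun h => hp (Finset.mem_of_mem_erase h)
    have hτ : eps {p} τ = eps {p} {q} * eps {p} (τ.erase q) := by
      rw [← eps_insert_right _ (Finset.notMem_erase q τ), Finset.insert_erase hq]
    rw [he, ← neg_smul, hτ, eps_insert_right _ hp', eps_singleton_swap hpq]
    congr 1
    linear_combination -(eps {q} (τ.erase q)) * eps {p} (τ.erase q) * eps_mul_self {q} {p}
  rw [h1, h2, Finset.sum_congr rfl fun p hp => Finset.sum_congr rfl fun q hq => h3 p hp q hq,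
    ← Finset.sum_add_sum_compl τ t, add_mul, Finset.sum_mul, Finset.sum_mul]
  simp only [Finset.sum_neg_distrib]
  abel

end Complex

/-! ### Closed families as cones over the vertex `0` -/

section Cone

variable {n : ℕ} {A : Type*} [CommRing A] [Algebra ℂ A]

theorem altD_insert_zero (b : Finset (Fin (n + 1)) → A) {σ : Finset (Fin (n + 1))} (h : 0 ∉ σ) :
    altD b (insert 0 σ)
      = b σ - ∑ p ∈ σ, eps {p} (σ.erase p) • b (insert 0 (σ.erase p)) := by
  unfold altD
  rw [Finset.sum_insert h, Finset.erase_insert h, eps_zero_left h, one_smul, sub_eq_add_neg,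
    ← Finset.sum_neg_distrib]
  congr 1
  refine Finset.sum_congr rfl fun p hp => ?_
  have hp0 : 0 ≠ p := fun e => h (e ▸ hp)
  have h0 : (0 : Fin (n + 1)) ∉ σ.erase p := fun h' => h (Finset.mem_of_mem_erase h')
  rw [Finset.erase_insert_of_ne hp0, eps_insert_right _ h0,
    eps_singleton_swap hp0.symm, eps_zero_left (by simpa using hp0), neg_one_mul, neg_smul]

/-- A family is closed iff its alternating difference vanishes at the tuples that contain `0`. -/
theorem altD_eq_zero_iff (b : Finset (Fin (n + 1)) → A) (k : ℕ) :
    (∀ θ, θ.card = k + 1 → altD b θ = 0) ↔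
      ∀ σ, σ.card = k → 0 ∉ σ →
        b σ - ∑ p ∈ σ, eps {p} (σ.erase p) • b (insert 0 (σ.erase p)) = 0 := by
  constructor
  · intro h σ hσ h0
    rw [← altD_insert_zero b h0]
    exact h _ (by rw [Finset.card_insert_of_notMem h0, hσ])
  · intro h θ hθ
    by_cases h0 : 0 ∈ θ
    · rw [← Finset.insert_erase h0, altD_insert_zero b (Finset.notMem_erase 0 θ)]
      exact h _ (by rw [Finset.card_erase_of_mem h0, hθ]; rfl) (Finset.notMem_erase 0 θ)
    -- If `0 ∉ θ`, every `b (θ - p)` can be replaced by its cone expression, and the resulting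
    -- double sum vanishes as in `D² = 0`.
    · have : altD b θ = ∑ p ∈ θ, ∑ q ∈ θ.erase p,
          (eps {p} (θ.erase p) * eps {q} ((θ.erase p).erase q)) •
            b (insert 0 ((θ.erase p).erase q)) := by
        unfold altD
        refine Finset.sum_congr rfl fun p hp => ?_
        rw [sub_eq_zero.1 (h (θ.erase p) (by rw [Finset.card_erase_of_mem hp, hθ]; rfl)
          fun h' => h0 (Finset.mem_of_mem_erase h')), Finset.smul_sum]
        refine Finset.sum_congr rfl fun q hq => ?_
        rw [smul_smul]
      rw [this]
      refine sum_sum_erase_eq_zero _ _ fun p hp q hq hpq => ?_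
      rw [Finset.erase_right_comm, ← neg_smul]
      congr 1
      have e1 : θ.erase p = insert q ((θ.erase q).erase p) := by
        rw [Finset.erase_right_comm, Finset.insert_erase (Finset.mem_erase.2 ⟨hpq.symm, hq⟩)]
      have e2 : θ.erase q = insert p ((θ.erase q).erase p) := by
        rw [Finset.insert_erase (Finset.mem_erase.2 ⟨hpq, hp⟩)]
      have h3 := eps_insert_mul_eps_swap hpq (Finset.notMem_erase p (θ.erase q))
        (q := q) (by simp)
      rwa [← e1, ← e2] at h3

end Cone

/-! ### Minors -/

section Minors

variable {N : ℕ}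

/-- The sign of the permutation that sorts the sequence `g`. -/
def sortSign {m : ℕ} (g : Fin m → Fin N) : ℂ :=
  ∏ i, ∏ j, if i < j then (if g i < g j then 1 else -1) else 1

theorem prod_orderEmbOfFin {m : ℕ} {τ : Finset (Fin N)} (h : τ.card = m) (F : Fin N → ℂ) :
    ∏ a ∈ τ, F a = ∏ i, F (τ.orderEmbOfFin h i) := by
  conv_lhs => rw [← Finset.map_orderEmbOfFin_univ τ h]
  rw [Finset.prod_map]
  rfl

theorem sortSign_orderEmbOfFin {m : ℕ} {τ : Finset (Fin N)} (h : τ.card = m) :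
    sortSign (τ.orderEmbOfFin h) = 1 := by
  refine Finset.prod_eq_one fun i _ => Finset.prod_eq_one fun j _ => ?_
  split_ifs with h1 h2
  · rfl
  · exact absurd ((τ.orderEmbOfFin h).lt_iff_lt.2 h1) h2
  · rfl

/-- Pairs within either block are in order, so only the pairs with one entry in each block
contribute. -/
theorem sortSign_append {k l : ℕ} {σ ρ : Finset (Fin N)} (hσ : σ.card = k) (hρ : ρ.card = l) :
    sortSign (Fin.append (σ.orderEmbOfFin hσ) (ρ.orderEmbOfFin hρ)) = eps σ ρ := by
  have h1 := sortSign_orderEmbOfFin hσ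
  have h2 := sortSign_orderEmbOfFin hρ
  unfold sortSign at h1 h2 ⊢
  rw [Fin.prod_univ_add]
  simp only [Fin.prod_univ_add, Fin.append_left, Fin.append_right, Finset.prod_mul_distrib]
  have e1 : ∀ i j : Fin k, (Fin.castAdd l i < Fin.castAdd l j) = (i < j) := fun i j => rfl
  have e2 : ∀ i j : Fin l, (Fin.natAdd k i < Fin.natAdd k j) = (i < j) := fun i j => by
    simp
  have e3 : ∀ (i : Fin k) (j : Fin l), Fin.castAdd l i < Fin.natAdd k j := fun i j => by
    rw [Fin.lt_def, Fin.val_castAdd, Fin.val_natAdd]; omega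
  have e4 : ∀ (i : Fin l) (j : Fin k), ¬ Fin.natAdd k i < Fin.castAdd l j := fun i j => by
    rw [Fin.lt_def, Fin.val_castAdd, Fin.val_natAdd]; omega
  simp only [e1, e2, e3, e4, if_true, if_false, h1, h2, Finset.prod_const_one, mul_one, one_mul]
  unfold eps
  rw [prod_orderEmbOfFin hσ]
  exact Finset.prod_congr rfl fun i _ => (prod_orderEmbOfFin hρ fun b =>
    if σ.orderEmbOfFin hσ i < b then 1 else -1).symm

theorem sortSign_cons {m : ℕ} (p : Fin N) {μ : Finset (Fin N)} (hμ : μ.card = m) :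
    sortSign (Fin.cons p (μ.orderEmbOfFin hμ) : Fin (m + 1) → Fin N) = eps {p} μ := by
  have h2 := sortSign_orderEmbOfFin hμ
  unfold sortSign at h2 ⊢
  rw [Fin.prod_univ_succ]
  simp only [Fin.prod_univ_succ, Fin.cons_zero, Fin.cons_succ]
  simp only [lt_irrefl, if_false, Fin.succ_pos, if_true, Fin.not_lt_zero, Fin.succ_lt_succ_iff,
    one_mul, h2, mul_one]
  unfold eps
  rw [Finset.prod_singleton]
  exact (prod_orderEmbOfFin hμ fun b => if p < b then 1 else -1).symm

/-- The minor of `M` with rows `τ`, and `0` if `τ` does not have `m` elements. -/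
def minor {m : ℕ} (M : Fin N → Fin m → ℂ) (τ : Finset (Fin N)) : ℂ :=
  if h : τ.card = m then Matrix.det (Matrix.of fun i j => M (τ.orderEmbOfFin h i) j) else 0

/-- Let `π` send `i` to the position of `g i` in the sorted image. The rows are those of the minor
permuted by `π`, and since the sorted enumeration is increasing, the inversions of `g` are those of
`π`. -/
theorem det_rows_eq {m : ℕ} (M : Fin N → Fin m → ℂ) {g : Fin m → Fin N}
    (hg : Function.Injective g) :
    Matrix.det (Matrix.of fun i j => M (g i) j)
      = sortSign g * minor M (Finset.univ.image g) := by
  have hc : (Finset.univ.image g).card = m := by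
    rw [Finset.card_image_of_injective _ hg, Finset.card_univ, Fintype.card_fin]
  set e := (Finset.univ.image g).orderIsoOfFin hc with he
  have hmem : ∀ i, g i ∈ Finset.univ.image g := fun i =>
    Finset.mem_image_of_mem _ (Finset.mem_univ i)
  have hinj : Function.Injective fun i => e.symm ⟨g i, hmem i⟩ := by
    intro i j h
    simpa using hg (congrArg Subtype.val (e.symm.injective h))
  set π : Equiv.Perm (Fin m) := Equiv.ofBijective _ (Finite.injective_iff_bijective.1 hinj) with hπ
  have hgπ : ∀ i, (Finset.univ.image g).orderEmbOfFin hc (π i) = g i := by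
    intro i
    rw [← Finset.coe_orderIsoOfFin_apply]
    simp [hπ, ← he]
  have hs : sortSign g = ((Equiv.Perm.sign π : ℤ) : ℂ) := by
    rw [Equiv.Perm.sign_eq_prod_prod_Ioi]
    push_cast
    unfold sortSign
    refine Finset.prod_congr rfl fun i _ => ?_
    rw [← Finset.prod_filter, Finset.filter_lt_eq_Ioi]
    refine Finset.prod_congr rfl fun j _ => ?_
    simp only [← hgπ i, ← hgπ j, OrderEmbedding.lt_iff_lt]
    split_ifs <;> simp
  rw [hs, minor, dif_pos hc, ← Matrix.det_permute]
  congr 1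
  ext i j
  simp [hgπ]

theorem image_append {k l : ℕ} {σ ρ : Finset (Fin N)} (hσ : σ.card = k) (hρ : ρ.card = l) :
    Finset.univ.image (Fin.append (σ.orderEmbOfFin hσ) (ρ.orderEmbOfFin hρ)) = σ ∪ ρ := by
  ext x
  rw [Finset.mem_union, ← Finset.mem_coe (s := σ), ← Finset.mem_coe (s := ρ),
    ← Finset.range_orderEmbOfFin σ hσ, ← Finset.range_orderEmbOfFin ρ hρ]
  simp only [Finset.mem_image, Finset.mem_univ, true_and, Set.mem_range]
  constructor
  · rintro ⟨i, rfl⟩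
    refine Fin.addCases (fun i => Or.inl ⟨i, ?_⟩) (fun j => Or.inr ⟨j, ?_⟩) i
    · rw [Fin.append_left]
    · rw [Fin.append_right]
  · rintro (⟨i, rfl⟩ | ⟨j, rfl⟩)
    · exact ⟨Fin.castAdd l i, Fin.append_left _ _ i⟩
    · exact ⟨Fin.natAdd k j, Fin.append_right _ _ j⟩

theorem det_append {k l : ℕ} (M : Fin N → Fin (k + l) → ℂ) {σ ρ : Finset (Fin N)}
    (hσ : σ.card = k) (hρ : ρ.card = l) (hd : Disjoint σ ρ) :
    Matrix.det (Matrix.of fun i j =>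
      M (Fin.append (σ.orderEmbOfFin hσ) (ρ.orderEmbOfFin hρ) i) j)
      = eps σ ρ * minor M (σ ∪ ρ) := by
  rw [det_rows_eq, sortSign_append, image_append]
  rw [Fin.append_injective_iff]
  refine ⟨(σ.orderEmbOfFin hσ).injective, (ρ.orderEmbOfFin hρ).injective, fun i j h => ?_⟩
  exact Finset.disjoint_left.1 hd (Finset.orderEmbOfFin_mem σ hσ i)
    (h ▸ Finset.orderEmbOfFin_mem ρ hρ j)

theorem det_append_of_not_disjoint {k l : ℕ} (M : Fin N → Fin (k + l) → ℂ) {σ ρ : Finset (Fin N)}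
    (hσ : σ.card = k) (hρ : ρ.card = l) (hd : ¬ Disjoint σ ρ) :
    Matrix.det (Matrix.of fun i j =>
      M (Fin.append (σ.orderEmbOfFin hσ) (ρ.orderEmbOfFin hρ) i) j) = 0 := by
  obtain ⟨a, ha, hb⟩ := Finset.not_disjoint_iff.1 hd
  obtain ⟨i, hi⟩ : a ∈ Set.range (σ.orderEmbOfFin hσ) := by
    rw [Finset.range_orderEmbOfFin]; exact ha
  obtain ⟨j, hj⟩ : a ∈ Set.range (ρ.orderEmbOfFin hρ) := by
    rw [Finset.range_orderEmbOfFin]; exact hb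
  refine Matrix.det_zero_of_row_eq (i := Fin.castAdd l i) (j := Fin.natAdd k j) ?_ ?_
  · rw [Ne, Fin.ext_iff, Fin.val_castAdd, Fin.val_natAdd]; omega
  · funext c
    simp [hi, hj]

theorem det_cons {m : ℕ} (M : Fin N → Fin (m + 1) → ℂ) {μ : Finset (Fin N)} (hμ : μ.card = m)
    {p : Fin N} (hp : p ∉ μ) :
    Matrix.det (Matrix.of (Fin.cons (M p) fun i => M (μ.orderEmbOfFin hμ i)))
      = eps {p} μ * minor M (insert p μ) := by
  have h := det_rows_eq M (g := (Fin.cons p (μ.orderEmbOfFin hμ) : Fin (m + 1) → Fin N)) (by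
    rw [Fin.cons_injective_iff, Finset.range_orderEmbOfFin]
    exact ⟨hp, (μ.orderEmbOfFin hμ).injective⟩)
  rw [sortSign_cons] at h
  have hi : Finset.univ.image (Fin.cons p (μ.orderEmbOfFin hμ) : Fin (m + 1) → Fin N)
      = insert p μ := by
    apply Finset.coe_injective
    rw [Finset.coe_image, Finset.coe_univ, Set.image_univ, Fin.range_cons,
      Finset.range_orderEmbOfFin, Finset.coe_insert]
  rw [hi] at h
  rw [← h]
  congr 1
  ext i j
  refine Fin.cases ?_ (fun i => ?_) i <;> simp

theorem det_cons_of_mem {m : ℕ} (M : Fin N → Fin (m + 1) → ℂ) {μ : Finset (Fin N)}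
    (hμ : μ.card = m) {p : Fin N} (hp : p ∈ μ) :
    Matrix.det (Matrix.of (Fin.cons (M p) fun i => M (μ.orderEmbOfFin hμ i))) = 0 := by
  obtain ⟨i, hi⟩ : p ∈ Set.range (μ.orderEmbOfFin hμ) := by
    rw [Finset.range_orderEmbOfFin]; exact hp
  refine Matrix.det_zero_of_row_eq (i := 0) (j := i.succ) (Fin.succ_ne_zero i).symm ?_
  funext c
  simp [hi]

/-- If the rows sum to zero, so do the minors that share all but one row. -/
theorem sum_minor_insert {m : ℕ} (M : Fin N → Fin (m + 1) → ℂ) (hM : ∑ p, M p = 0)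
    {μ : Finset (Fin N)} (hμ : μ.card = m) :
    ∑ p ∈ μᶜ, eps {p} μ * minor M (insert p μ) = 0 := by
  have h1 : ∀ v : Fin (m + 1) → ℂ,
      Matrix.det (Matrix.of (Fin.cons v fun i => M (μ.orderEmbOfFin hμ i)))
        = (Matrix.detRowAlternating (R := ℂ)).toMultilinearMap.toLinearMap
          (Fin.cons 0 fun i => M (μ.orderEmbOfFin hμ i)) 0 v := by
    intro v
    rw [MultilinearMap.toLinearMap_apply, Fin.update_cons_zero]
    rfl
  have h2 : ∑ p, Matrix.det (Matrix.of (Fin.cons (M p) fun i => M (μ.orderEmbOfFin hμ i))) = 0 := by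
    simp only [h1]
    rw [← map_sum, hM, map_zero]
  rw [← Finset.sum_add_sum_compl μ, Finset.sum_eq_zero fun p hp => det_cons_of_mem M hμ hp,
    zero_add] at h2
  rw [← h2]
  exact Finset.sum_congr rfl fun p hp => (det_cons M hμ (Finset.mem_compl.1 hp)).symm

theorem minor_eq_zero_of_row {m : ℕ} (M : Fin N → Fin m → ℂ) {τ : Finset (Fin N)} {q : Fin N}
    (hq : q ∈ τ) (h : M q = 0) : minor M τ = 0 := by
  unfold minor
  split_ifs with hc
  · obtain ⟨i, hi⟩ : q ∈ Set.range (τ.orderEmbOfFin hc) := by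
      rw [Finset.range_orderEmbOfFin]; exact hq
    refine Matrix.det_eq_zero_of_row_eq_zero i fun j => ?_
    simp [hi, h]
  · rfl

/-- If the rows vanish outside of `θ` and sum to zero, then the minors of the rows `θ - p` agree
up to sign. -/
theorem eps_mul_minor_erase {m : ℕ} (M : Fin N → Fin m → ℂ) {θ : Finset (Fin N)}
    (hθ : θ.card = m + 1) (hM : ∑ p, M p = 0) (h0 : ∀ p, p ∉ θ → M p = 0) {a q : Fin N}
    (ha : a ∈ θ) (hq : q ∈ θ) :
    eps {q} (θ.erase q) * minor M (θ.erase q) = eps {a} (θ.erase a) * minor M (θ.erase a) := by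
  rcases eq_or_ne a q with rfl | haq
  · rfl
  set μ := (θ.erase a).erase q with hμ
  have haμ : a ∉ μ := by simp [hμ]
  have hqμ : q ∉ μ := by simp [hμ]
  have e1 : θ.erase a = insert q μ := by
    rw [hμ, Finset.insert_erase (Finset.mem_erase.2 ⟨haq.symm, hq⟩)]
  have e2 : θ.erase q = insert a μ := by
    rw [hμ, Finset.erase_right_comm, Finset.insert_erase (Finset.mem_erase.2 ⟨haq, ha⟩)]
  have hcard : μ.card + 1 = m := by
    have := Finset.card_insert_of_notMem hqμ
    rw [← e1, Finset.card_erase_of_mem ha, hθ] at this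
    omega
  obtain ⟨m', rfl⟩ : ∃ m', m = m' + 1 := ⟨_, hcard.symm⟩
  -- With `μ = θ - a - q`, inserting any index other than `a` and `q` brings in a row outside `θ`,
  -- which is zero. The relation reduces to two terms.
  have hs := sum_minor_insert M hM (μ := μ) (by omega)
  have hsub : ({a, q} : Finset (Fin N)) ⊆ μᶜ := by
    intro x hx
    rw [Finset.mem_compl]
    rcases Finset.mem_insert.1 hx with rfl | hx
    · exact haμ
    · rw [Finset.mem_singleton.1 hx]; exact hqμ
  rw [← Finset.sum_subset hsub, Finset.sum_pair haq] at hs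
  · rw [e1, e2, eps_insert_right _ haμ, eps_insert_right _ hqμ, eps_singleton_swap haq]
    linear_combination (eps {q} {a} * eps {q} μ * eps {a} μ) * hs
      - eps {q} {a} * eps {q} μ * minor M (insert a μ) * eps_mul_self {a} μ
      - eps {q} {a} * eps {a} μ * minor M (insert q μ) * eps_mul_self {q} μ
  · intro p hp hpn
    have hpθ : p ∉ θ := by
      intro hpθ
      rw [Finset.mem_compl] at hp
      simp only [Finset.mem_insert, Finset.mem_singleton, not_or] at hpn
      exact hp (Finset.mem_erase.2 ⟨hpn.2, Finset.mem_erase.2 ⟨hpn.1, hpθ⟩⟩)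
    rw [minor_eq_zero_of_row M (Finset.mem_insert_self p μ) (h0 p hpθ), mul_zero]

/-- A combination of minors of a matrix whose rows sum to zero vanishes if the alternating
difference of the coefficients does. -/
theorem sum_mul_minor_eq_zero {n m : ℕ} (M : Fin (n + 1) → Fin m → ℂ) (hM : ∑ p, M p = 0)
    (b : Finset (Fin (n + 1)) → ℂ) (hb : ∀ θ, θ.card = m + 1 → altD b θ = 0) :
    ∑ σ ∈ altIndices m n, b σ * minor M σ = 0 := by
  have hb' := (altD_eq_zero_iff b m).1 hb
  cases m with
  | zero =>
    -- In degree zero nothing can be removed from `∅`, so the cone condition there says that `b ∅ =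
    -- 0`.
    refine Finset.sum_eq_zero fun σ hσ => ?_
    rw [Finset.mem_powersetCard_univ, Finset.card_eq_zero] at hσ
    subst hσ
    have := hb' ∅ rfl (Finset.notMem_empty _)
    rw [Finset.sum_empty, sub_zero] at this
    rw [this, zero_mul]
  | succ k =>
    -- The cone over vertex `0` is a primitive: `b = Dc`. Regrouping by `μ = σ - p` then leaves, for
    -- each `μ`, a multiple of the relation `sum_minor_insert`.
    set c : Finset (Fin (n + 1)) → ℂ := fun μ => if 0 ∈ μ then 0 else b (insert 0 μ) with hc
    have hbc : ∀ σ, σ.card = k + 1 → b σ = ∑ p ∈ σ, eps {p} (σ.erase p) * c (σ.erase p) := by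
      intro σ hσ
      by_cases h0 : 0 ∈ σ
      · rw [Finset.sum_eq_single_of_mem 0 h0]
        · rw [eps_zero_left (Finset.notMem_erase _ _), one_mul]
          simp [hc, Finset.insert_erase h0]
        · intro p hp hp0
          rw [hc]
          simp [h0, hp0.symm]
      · rw [sub_eq_zero.1 (hb' σ hσ h0)]
        refine Finset.sum_congr rfl fun p hp => ?_
        simp [hc, h0]
    have h1 : ∑ σ ∈ altIndices (k + 1) n, b σ * minor M σ
        = ∑ σ ∈ altIndices (k + 1) n, ∑ p ∈ σ,
          c (σ.erase p) * (eps {p} (σ.erase p) * minor M (insert p (σ.erase p))) := by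
      refine Finset.sum_congr rfl fun σ hσ => ?_
      rw [hbc σ (Finset.mem_powersetCard_univ.1 hσ), Finset.sum_mul]
      refine Finset.sum_congr rfl fun p hp => ?_
      rw [Finset.insert_erase hp]; ring
    rw [h1, ← sum_compl_eq_sum_erase k fun μ p => c μ * (eps {p} μ * minor M (insert p μ))]
    refine Finset.sum_eq_zero fun μ hμ => ?_
    rw [← Finset.mul_sum, sum_minor_insert M hM (Finset.mem_powersetCard_univ.1 hμ), mul_zero]

/-- If the rows vanish outside of `θ` and sum to zero, then a combination of minors is, up to
sign, a single minor times the alternating difference at `θ`. -/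
theorem sum_mul_minor_eq_altD {n m : ℕ} (M : Fin (n + 1) → Fin m → ℂ) (hM : ∑ p, M p = 0)
    {θ : Finset (Fin (n + 1))} (hθ : θ.card = m + 1) (h0 : ∀ p, p ∉ θ → M p = 0)
    {a : Fin (n + 1)} (ha : a ∈ θ) (b : Finset (Fin (n + 1)) → ℂ) :
    ∑ σ ∈ altIndices m n, b σ * minor M σ
      = altD b θ * (eps {a} (θ.erase a) * minor M (θ.erase a)) := by
  rw [← Finset.sum_subset (Finset.powersetCard_mono (Finset.subset_univ θ)),
    sum_powersetCard_eq_sum_erase hθ, altD, Finset.sum_mul]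
  · refine Finset.sum_congr rfl fun q hq => ?_
    rw [← eps_mul_minor_erase M hθ hM h0 ha hq, smul_eq_mul]
    linear_combination -(b (θ.erase q) * minor M (θ.erase q)) *
      eps_mul_self {q} (θ.erase q)
  · intro σ hσ hn
    obtain ⟨q, hq, hqθ⟩ : ∃ q ∈ σ, q ∉ θ := by
      by_contra! hcon
      exact hn (Finset.mem_powersetCard.2 ⟨hcon, Finset.mem_powersetCard_univ.1 hσ⟩)
    rw [minor_eq_zero_of_row M hq (h0 q hqθ), mul_zero]

end Minors

/-! ### Bilinearity of the exterior product -/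

section Wedge

variable {V : Type*} [AddCommGroup V] [Module ℝ V] {k l : ℕ}

/-- `domCoprod` is built over `ℝ` with values in a tensor product. This shuffle expansion shows the
two facts needed later: linearity over `ℂ` in each factor, and continuity when the factors vary
continuously. -/
theorem wedge_eq_sum (a : V [⋀^Fin k]→ₗ[ℝ] ℂ) (b : V [⋀^Fin l]→ₗ[ℝ] ℂ) (v : Fin (k + l) → V) :
    wedge a b v = ∑ s : Equiv.Perm.ModSumCongr (Fin k) (Fin l),
      ((Equiv.Perm.sign s.out : ℤ) : ℂ) *
        (a (fun i => v (finSumFinEquiv (s.out (Sum.inl i)))) *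
          b fun j => v (finSumFinEquiv (s.out (Sum.inr j)))) := by
  rw [wedge, AlternatingMap.domDomCongr_apply, LinearMap.compAlternatingMap_apply,
    AlternatingMap.domCoprod_apply, sum_apply, map_sum]
  refine Finset.sum_congr rfl fun s _ => ?_
  conv_lhs => rw [← Quotient.out_eq' s]
  rw [AlternatingMap.domCoprod.summand_mk'', Units.smul_def, smul_apply, map_zsmul, zsmul_eq_mul]
  rfl

/-- The exterior product as a bilinear map over `ℂ`. -/
def wedgeBilin : (V [⋀^Fin k]→ₗ[ℝ] ℂ) →ₗ[ℂ] (V [⋀^Fin l]→ₗ[ℝ] ℂ) →ₗ[ℂ]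
    (V [⋀^Fin (k + l)]→ₗ[ℝ] ℂ) :=
  LinearMap.mk₂ ℂ wedge
    (fun a a' b => by
      ext v
      simp only [AlternatingMap.add_apply, wedge_eq_sum, add_mul, mul_add, Finset.sum_add_distrib])
    (fun c a b => by
      ext v
      simp only [AlternatingMap.smul_apply, wedge_eq_sum, smul_eq_mul, Finset.mul_sum]
      exact Finset.sum_congr rfl fun s _ => by ring)
    (fun a b b' => by
      ext v
      simp only [AlternatingMap.add_apply, wedge_eq_sum, mul_add, Finset.sum_add_distrib])
    (fun c a b => by
      ext v
      simp only [AlternatingMap.smul_apply, wedge_eq_sum, smul_eq_mul, Finset.mul_sum]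
      exact Finset.sum_congr rfl fun s _ => by ring)

theorem wedgeBilin_apply (a : V [⋀^Fin k]→ₗ[ℝ] ℂ) (b : V [⋀^Fin l]→ₗ[ℝ] ℂ) :
    wedgeBilin a b = wedge a b := rfl

theorem alternatingMap_sum_smul_apply {ι : Type*} (s : Finset ι) (c : ι → ℂ)
    (a : ι → V [⋀^Fin k]→ₗ[ℝ] ℂ) (v : Fin k → V) :
    (∑ i ∈ s, c i • a i) v = ∑ i ∈ s, c i * a i v := by
  classical
  induction s using Finset.induction_on with
  | empty => simp
  | insert i s hi ih =>
    rw [Finset.sum_insert hi, Finset.sum_insert hi, AlternatingMap.add_apply, ih]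
    rfl

theorem wedge_sum_smul {ι κ : Type*} (s : Finset ι) (t : Finset κ) (c : ι → ℂ) (d : κ → ℂ)
    (a : ι → V [⋀^Fin k]→ₗ[ℝ] ℂ) (b : κ → V [⋀^Fin l]→ₗ[ℝ] ℂ) (v : Fin (k + l) → V) :
    wedge (∑ i ∈ s, c i • a i) (∑ j ∈ t, d j • b j) v
      = ∑ j ∈ t, d j * ∑ i ∈ s, c i * wedge (a i) (b j) v := by
  simp only [← wedgeBilin_apply, map_sum, map_smul, LinearMap.sum_apply, LinearMap.smul_apply]
  rw [alternatingMap_sum_smul_apply]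
  simp only [alternatingMap_sum_smul_apply]

end Wedge

/-! ### Barycentric coordinates -/

section Bary

variable {E : Type*} [NormedAddCommGroup E] [InnerProductSpace ℝ E] {n : ℕ}
  (T : Affine.Simplex ℝ E n)

theorem points_mem (j : Fin (n + 1)) : T.points j ∈ affineSpan ℝ (Set.range T.points) :=
  mem_affineSpan ℝ (Set.mem_range_self _)

theorem baryAffine_points (i j : Fin (n + 1)) :
    baryAffine T i ⟨T.points j, points_mem T j⟩ = if i = j then 1 else 0 :=
  (vertexBasis T).coord_apply i j

theorem dlamOne_sub (i : Fin (n + 1)) (x y : affineSpan ℝ (Set.range T.points))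
    (h : (x : E) - y ∈ tangent T) :
    dlamOne T i ⟨x - y, h⟩ = ((baryAffine T i x : ℝ) : ℂ) - ((baryAffine T i y : ℝ) : ℂ) := by
  have h1 : (⟨x - y, h⟩ : tangent T) = x -ᵥ y := rfl
  rw [h1, dlamOne, LinearMap.comp_apply, AffineMap.linearMap_vsub]
  simp

theorem points_sub_mem (j a : Fin (n + 1)) : T.points j - T.points a ∈ tangent T :=
  AffineSubspace.vsub_mem_direction (points_mem T j) (points_mem T a)

theorem dlamOne_points_sub (i j a : Fin (n + 1)) :
    dlamOne T i ⟨T.points j - T.points a, points_sub_mem T j a⟩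
      = (if i = j then 1 else 0) - (if i = a then 1 else 0) := by
  rw [dlamOne_sub T i ⟨T.points j, points_mem T j⟩ ⟨T.points a, points_mem T a⟩,
    baryAffine_points, baryAffine_points]
  split_ifs <;> simp

/-- Differentiate `∑ λ_i = 1`. This provides the hypothesis that rows sum to zero in the lemmas on
minors. -/
theorem sum_dlamOne (w : tangent T) : ∑ i, dlamOne T i w = 0 := by
  set y : affineSpan ℝ (Set.range T.points) := ⟨T.points 0, points_mem T 0⟩ with hy
  obtain ⟨x, rfl⟩ : ∃ x : affineSpan ℝ (Set.range T.points), x -ᵥ y = w := ⟨w +ᵥ y, by simp⟩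
  have h : ∀ i, dlamOne T i (x -ᵥ y)
      = ((baryAffine T i x : ℝ) : ℂ) - ((baryAffine T i y : ℝ) : ℂ) := fun i =>
    dlamOne_sub T i x y _
  simp only [h, Finset.sum_sub_distrib, ← Complex.ofReal_sum]
  have h1 : ∀ z, ∑ i, baryAffine T i z = 1 := (vertexBasis T).sum_coord_apply_eq_one
  rw [h1, h1, sub_self]

theorem lam_eq (i a : Fin (n + 1)) (x : body T) (h : (x : E) - T.points a ∈ tangent T) :
    lam T i x = (if i = a then 1 else 0) + dlamOne T i ⟨x - T.points a, h⟩ := by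
  rw [dlamOne_sub T i ⟨x, convexHull_subset_affineSpan _ x.2⟩ ⟨T.points a, points_mem T a⟩,
    baryAffine_points, lam]
  split_ifs <;> simp

/-- The barycentric coordinates in terms of the coordinates on the reference simplex. -/
def refCoord (y : Fin n → ℝ) : Fin (n + 1) → ℝ :=
  Fin.cons (1 - ∑ i, y i) y

theorem lam_param (i : Fin (n + 1)) (y : refSimplex n) :
    lam T i (param T y) = (refCoord y.1 i : ℝ) := by
  have hs : ∑ j : Fin n, y.1 j • (T.points j.succ - T.points 0) ∈ tangent T :=
    Submodule.sum_mem _ fun j _ => Submodule.smul_mem _ _ (points_sub_mem T _ _)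
  have he : (param T y : E) - T.points 0 = ∑ j : Fin n, y.1 j • (T.points j.succ - T.points 0) := by
    simp [param]
  rw [lam_eq T i 0 _ (by rw [he]; exact hs)]
  have h1 : (⟨(param T y : E) - T.points 0, by rw [he]; exact hs⟩ : tangent T)
      = ∑ j : Fin n, y.1 j • ⟨T.points j.succ - T.points 0, points_sub_mem T j.succ 0⟩ := by
    apply Subtype.ext
    rw [AddSubmonoidClass.coe_finsetSum]
    exact he
  rw [h1, map_sum]
  simp only [map_smul, dlamOne_points_sub, refCoord]
  refine Fin.cases ?_ (fun i => ?_) i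
  · simp [(Fin.succ_ne_zero _).symm, sub_eq_add_neg]
  · simp [Fin.succ_ne_zero]

theorem dlam_apply (k : ℕ) (σ : Finset (Fin (n + 1))) (x : body T) (v : Fin k → tangent T) :
    dlam T k σ x v = minor (fun p j => dlamOne T p (v j)) σ := by
  unfold dlam minor
  split_ifs with h
  · rw [wedgeOne_apply]
  · rfl

theorem sum_rows (k : ℕ) (v : Fin k → tangent T) :
    ∑ p, (fun j => dlamOne T p (v j)) = 0 := by
  funext j
  simpa using sum_dlamOne T (v j)

/-! ### The top-dimensional exterior products -/

theorem dlamOne_edge (p : Fin (n + 1)) (j : Fin n) :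
    dlamOne T p (edge T j) = (if p = j.succ then 1 else 0) - (if p = 0 then 1 else 0) :=
  dlamOne_points_sub T p j.succ 0

/-- For `p = 0` the matrix `dλ_{i+1}(v_{j+1} - v_0)` is the identity; the other minors are compared
with this one by `eps_mul_minor_erase` with `θ` the full vertex set. -/
theorem minor_edge {m : ℕ} (h : m = n) (p : Fin (n + 1)) :
    minor (fun p j => dlamOne T p (edge T (Fin.cast h j))) (Finset.univ.erase p)
      = eps {p} (Finset.univ.erase p) := by
  subst h
  have hc : (Finset.univ : Finset (Fin (m + 1))).card = m + 1 := by simp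
  have hc0 : ((Finset.univ : Finset (Fin (m + 1))).erase 0).card = m := by simp
  have h1 := eps_mul_minor_erase (fun p j => dlamOne T p (edge T (Fin.cast rfl j))) hc
    (sum_rows T _ _) (fun p hp => absurd (Finset.mem_univ p) hp) (Finset.mem_univ 0)
    (Finset.mem_univ p)
  have h2 : (minor (fun p j => dlamOne T p (edge T (Fin.cast rfl j))) (Finset.univ.erase 0)) = 1 := by
    rw [minor, dif_pos hc0, ← Matrix.det_one (n := Fin m)]
    congr 1
    ext i j
    rw [Matrix.of_apply, dlamOne_edge, ← Finset.orderEmbOfFin_unique hc0 (f := Fin.succ)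
      (fun x => by simp) (Fin.strictMono_succ)]
    simp [Matrix.one_apply]
  rw [h2, eps_zero_left (Finset.notMem_erase _ _), one_mul] at h1
  linear_combination eps {p} (Finset.univ.erase p) * h1 -
    minor (fun p j => dlamOne T p (edge T (Fin.cast rfl j))) (Finset.univ.erase p) *
      eps_mul_self {p} (Finset.univ.erase p)

theorem wedge_dlam_apply {k l : ℕ} {σ τ : Finset (Fin (n + 1))} (hσ : σ.card = k)
    (hτ : τ.card = l) (x : body T) (v : Fin (k + l) → tangent T) :
    wedge (dlam T k σ x) (dlam T l τ x) v
      = Matrix.det (Matrix.of fun i j => dlamOne T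
        (Fin.append (σ.orderEmbOfFin hσ) (τ.orderEmbOfFin hτ) i) (v j)) := by
  have e : ∀ i, Fin.append (fun i => dlamOne T (σ.orderEmbOfFin hσ i))
      (fun i => dlamOne T (τ.orderEmbOfFin hτ i)) i
      = dlamOne T (Fin.append (σ.orderEmbOfFin hσ) (τ.orderEmbOfFin hτ) i) := by
    intro i
    refine Fin.addCases (fun i => ?_) (fun i => ?_) i <;> simp
  rw [dlam, dlam, dif_pos hσ, dif_pos hτ, wedge_wedgeOne, wedgeOne_apply]
  simp only [e]

theorem eps_union_right {m : ℕ} (σ : Finset (Fin m)) {ρ τ : Finset (Fin m)} (h : Disjoint ρ τ) :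
    eps σ (ρ ∪ τ) = eps σ ρ * eps σ τ := by
  simp only [eps, Finset.prod_union h, Finset.prod_mul_distrib]

/-- Wedging with `dλ_{θᶜ}` computes the alternating difference at `θ`. -/
theorem sum_mul_wedge_dlam_compl {k l : ℕ} (h : k + l = n) {θ : Finset (Fin (n + 1))}
    (hθ : θ.card = k + 1) (c : Finset (Fin (n + 1)) → ℂ) (x : body T) :
    ∑ σ ∈ altIndices k n,
      c σ * wedge (dlam T k σ x) (dlam T l θᶜ x) (fun j => edge T (Fin.cast h j))
      = eps θ θᶜ * altD c θ := by
  have hθc : θᶜ.card = l := by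
    rw [Finset.card_compl, Fintype.card_fin, hθ]; omega
  -- If `σ ⊄ θ`, then `σ` meets `θᶜ` and the product has a repeated factor. This leaves `σ = θ - p`,
  -- for which the rows sort to all indices except `p`.
  rw [← Finset.sum_subset (Finset.powersetCard_mono (Finset.subset_univ θ)),
    sum_powersetCard_eq_sum_erase hθ, altD, Finset.mul_sum]
  · refine Finset.sum_congr rfl fun p hp => ?_
    have hpc : (θ.erase p).card = k := by rw [Finset.card_erase_of_mem hp, hθ]; rfl
    have hd : Disjoint (θ.erase p) θᶜ :=
      Finset.disjoint_of_subset_left (Finset.erase_subset _ _) disjoint_compl_right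
    have hu : θ.erase p ∪ θᶜ = Finset.univ.erase p := by
      ext q
      by_cases hq : q = p
      · subst hq; simp [hp]
      · simp [hq, em]
    rw [wedge_dlam_apply T hpc hθc, det_append (fun p j => dlamOne T p (edge T (Fin.cast h j))) hpc
      hθc hd, hu, minor_edge T h, ← hu, eps_union_right _ hd, smul_eq_mul]
    have h2 : eps θ θᶜ = eps {p} θᶜ * eps (θ.erase p) θᶜ := by
      rw [← eps_insert_left _ (Finset.notMem_erase p θ), Finset.insert_erase hp]
    rw [h2]
    ring
  · intro σ hσ hn
    rw [Finset.mem_powersetCard_univ] at hσ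
    rw [wedge_dlam_apply T hσ hθc, det_append_of_not_disjoint
      (fun p j => dlamOne T p (edge T (Fin.cast h j))) hσ hθc, mul_zero]
    rw [disjoint_compl_right_iff]
    exact fun hle => hn (Finset.mem_powersetCard.2 ⟨hle, hσ⟩)

theorem wedge_sum_dlam_compl {k l : ℕ} (h : k + l = n) (c H : Finset (Fin (n + 1)) → ℂ)
    (x : body T) :
    wedge (∑ σ ∈ altIndices k n, c σ • dlam T k σ x)
      (∑ θ ∈ altIndices (k + 1) n, H θ • dlam T l θᶜ x) (fun j => edge T (Fin.cast h j))
      = ∑ θ ∈ altIndices (k + 1) n, H θ * (eps θ θᶜ * altD c θ) := by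
  rw [wedge_sum_smul]
  refine Finset.sum_congr rfl fun θ hθ => ?_
  rw [sum_mul_wedge_dlam_compl T h (Finset.mem_powersetCard_univ.1 hθ)]

/-- The term of `φ_{σᶜ}` that splits off `q` carries `λ_σ λ_q = λ_θ` and `dλ_{θᶜ}` with `θ = σ + q`,
so terms with the same `θ` combine; `eps_erase_compl` turns their signs into those of `D`. The dual
form therefore depends on `b` only through `Db`. -/
theorem sum_whitney_compl {k l : ℕ} (b : Finset (Fin (n + 1)) → ℂ) (x : body T) :
    ∑ σ ∈ altIndices k n, (eps σ σᶜ * b σ * lamProd T σ x) • whitney T l σᶜ x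
      = ∑ θ ∈ altIndices (k + 1) n,
        ((-1) ^ k * lamProd T θ x * altD b θ * eps θ θᶜ) • dlam T l θᶜ x := by
  have h1 : ∀ σ ∈ altIndices k n, (eps σ σᶜ * b σ * lamProd T σ x) • whitney T l σᶜ x
      = ∑ q ∈ σᶜ, (eps σ σᶜ * b σ * lamProd T σ x * (eps {q} (σᶜ.erase q) * lam T q x)) •
          dlam T l (σᶜ.erase q) x := by
    intro σ _
    rw [whitney, Finset.smul_sum]
    simp only [smul_smul]
  rw [Finset.sum_congr rfl h1, sum_compl_eq_sum_erase k fun σ q =>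
    (eps σ σᶜ * b σ * lamProd T σ x * (eps {q} (σᶜ.erase q) * lam T q x)) •
          dlam T l (σᶜ.erase q) x]
  refine Finset.sum_congr rfl fun θ hθ => ?_
  rw [Finset.mem_powersetCard_univ] at hθ
  rw [altD, Finset.mul_sum, Finset.sum_mul, Finset.sum_smul]
  refine Finset.sum_congr rfl fun p hp => ?_
  have e1 : (θ.erase p)ᶜ.erase p = θᶜ := by
    rw [Finset.compl_erase, Finset.erase_insert (by simpa using hp)]
  have e2 : lamProd T θ x = lam T p x * lamProd T (θ.erase p) x :=
    (Finset.mul_prod_erase θ (fun i => lam T i x) hp).symm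
  have e3 := eps_erase_compl hp
  rw [hθ, Nat.add_sub_cancel] at e3
  rw [e1, e2, smul_eq_mul]
  congr 1
  linear_combination (b (θ.erase p) * lamProd T (θ.erase p) x * lam T p x) * e3

/-- The pointwise form of the pairing. -/
theorem wedge_sum_whitney_compl {k l : ℕ} (h : k + l = n) (c b : Finset (Fin (n + 1)) → ℂ)
    (x : body T) :
    wedge (∑ σ ∈ altIndices k n, c σ • dlam T k σ x)
      (∑ ρ ∈ altIndices k n, (eps ρ ρᶜ * b ρ * lamProd T ρ x) • whitney T l ρᶜ x)
      (fun j => edge T (Fin.cast h j))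
      = (-1) ^ k * ∑ θ ∈ altIndices (k + 1) n, lamProd T θ x * (altD c θ * altD b θ) := by
  rw [sum_whitney_compl, wedge_sum_dlam_compl T h c (fun θ =>
    (-1) ^ k * lamProd T θ x * altD b θ * eps θ θᶜ), Finset.mul_sum]
  refine Finset.sum_congr rfl fun θ _ => ?_
  linear_combination ((-1) ^ k * lamProd T θ x * altD b θ * altD c θ) * eps_mul_self θ θᶜ

/-- By `minor_edge` the signs in each summand square to one, leaving `∑ λ_p = 1`. Integrating `f
φ_T` thus means integrating `f` over the reference simplex. -/
theorem whitneyTop_edge (y : refSimplex n) :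
    whitneyTop T (param T y) (fun j => edge T (Fin.cast rfl j)) = 1 := by
  rw [whitneyTop, whitney, alternatingMap_sum_smul_apply]
  have h1 : ∀ p ∈ (Finset.univ : Finset (Fin (n + 1))),
      eps {p} (Finset.univ.erase p) * lam T p (param T y) *
        dlam T n (Finset.univ.erase p) (param T y) (fun j => edge T (Fin.cast rfl j))
      = (refCoord y.1 p : ℝ) := by
    intro p _
    rw [dlam_apply, minor_edge T rfl, lam_param]
    linear_combination ((refCoord y.1 p : ℝ) : ℂ) * eps_mul_self {p} (Finset.univ.erase p)
  rw [Finset.sum_congr rfl h1, ← Complex.ofReal_sum]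
  simp [refCoord, Fin.sum_univ_succ]

end Bary

/-! ### Homogeneous polynomials in the barycentric coordinates -/

section Poly

open MvPolynomial

theorem eval_smul_of_isHomogeneous {ι : Type*} [Fintype ι] {p : MvPolynomial ι ℂ} {s : ℕ}
    (hp : p.IsHomogeneous s) (c : ℂ) (t : ι → ℂ) :
    eval (fun i => c * t i) p = c ^ s * eval t p := by
  rw [eval_eq', eval_eq', Finset.mul_sum]
  refine Finset.sum_congr rfl fun d hd => ?_
  have h : ∑ i, d i = s := by
    by_contra h
    exact (mem_support_iff.1 hd) (hp.coeff_eq_zero (by rwa [Finsupp.degree_eq_sum]))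
  simp only [mul_pow, Finset.prod_mul_distrib, Finset.prod_pow_eq_pow_sum, h]
  ring

/-- A polynomial that vanishes at the positive points vanishes. -/
theorem eq_zero_of_eval_pos {ι : Type*} {p : MvPolynomial ι ℂ}
    (h : ∀ t : ι → ℝ, (∀ i, 0 < t i) → eval (fun i => (t i : ℂ)) p = 0) : p = 0 := by
  refine funext_set (fun _ => Complex.ofReal '' Set.Ioi 0)
    (fun _ => (Set.Ioi_infinite 0).image Complex.ofReal_injective.injOn) fun x hx => ?_
  choose t ht htx using fun i => hx i (Set.mem_univ i)
  have : x = fun i => ((t i : ℝ) : ℂ) := funext fun i => (htx i).symm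
  rw [this, h t ht, map_zero]

/-- A homogeneous polynomial that vanishes on the interior of the simplex vanishes. -/
theorem eq_zero_of_isHomogeneous {n s : ℕ} {p : MvPolynomial (Fin (n + 1)) ℂ}
    (hp : p.IsHomogeneous s)
    (h : ∀ t : Fin (n + 1) → ℝ, (∀ i, 0 < t i) → ∑ i, t i = 1 →
      eval (fun i => (t i : ℂ)) p = 0) : p = 0 := by
  refine eq_zero_of_eval_pos fun t ht => ?_
  have hS : 0 < ∑ i, t i := Finset.sum_pos (fun i _ => ht i) Finset.univ_nonempty
  -- Any positive point can be rescaled into the simplex, and homogeneity changes the value only by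
  -- a nonzero factor.
  have h1 := h (fun i => (∑ i, t i)⁻¹ * t i) (fun i => mul_pos (inv_pos.2 hS) (ht i))
    (by rw [← Finset.mul_sum, inv_mul_cancel₀ hS.ne'])
  simp only [Complex.ofReal_mul] at h1
  rw [eval_smul_of_isHomogeneous hp] at h1
  refine (mul_eq_zero.1 h1).resolve_left (pow_ne_zero _ ?_)
  exact_mod_cast (inv_pos.2 hS).ne'

variable {n : ℕ}

/-- The homogeneous polynomial with the given coefficients. -/
def coefPoly (r : ℕ) (a : (Fin (n + 1) → ℕ) → ℂ) : MvPolynomial (Fin (n + 1)) ℂ :=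
  ∑ α ∈ multiIndices r n, monomial (Finsupp.equivFunOnFinite.symm α) (a α)

theorem mem_multiIndices {r : ℕ} {α : Fin (n + 1) → ℕ} :
    α ∈ multiIndices r n ↔ ∑ i, α i = r := by
  simp [multiIndices, Finset.mem_piAntidiag]

theorem eval_coefPoly (r : ℕ) (a : (Fin (n + 1) → ℕ) → ℂ) (t : Fin (n + 1) → ℂ) :
    eval t (coefPoly r a) = ∑ α ∈ multiIndices r n, a α * ∏ i, t i ^ α i := by
  rw [coefPoly, map_sum]
  refine Finset.sum_congr rfl fun α _ => ?_
  rw [eval_monomial, Finsupp.prod_fintype _ _ (fun i => pow_zero _)]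
  rfl

theorem isHomogeneous_coefPoly (r : ℕ) (a : (Fin (n + 1) → ℕ) → ℂ) :
    (coefPoly r a).IsHomogeneous r := by
  refine IsHomogeneous.sum _ _ _ fun α hα => isHomogeneous_monomial _ ?_
  rw [Finsupp.degree_eq_sum]
  exact mem_multiIndices.1 hα

theorem coeff_coefPoly {r : ℕ} (a : (Fin (n + 1) → ℕ) → ℂ) {α : Fin (n + 1) → ℕ}
    (hα : α ∈ multiIndices r n) :
    coeff (Finsupp.equivFunOnFinite.symm α) (coefPoly r a) = a α := by
  rw [coefPoly, coeff_sum, Finset.sum_eq_single_of_mem α hα]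
  · rw [coeff_monomial, if_pos rfl]
  · intro β _ hβ
    rw [coeff_monomial, if_neg]
    exact fun h => hβ (Finsupp.equivFunOnFinite.symm.injective h)

theorem coefPoly_coeff {r : ℕ} {p : MvPolynomial (Fin (n + 1)) ℂ} (hp : p.IsHomogeneous r) :
    coefPoly r (fun α => coeff (Finsupp.equivFunOnFinite.symm α) p) = p := by
  ext d
  obtain ⟨α, rfl⟩ := Finsupp.equivFunOnFinite.symm.surjective d
  by_cases hα : α ∈ multiIndices r n
  · rw [coeff_coefPoly _ hα]
  · have hd : (Finsupp.equivFunOnFinite.symm α).degree ≠ r := by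
      rw [Finsupp.degree_eq_sum]
      exact fun h => hα (mem_multiIndices.2 h)
    rw [hp.coeff_eq_zero hd, (isHomogeneous_coefPoly r _).coeff_eq_zero hd]

end Poly

/-! ### The reference simplex -/

section Reference

variable {n : ℕ}

theorem isCompact_refSimplex (n : ℕ) : IsCompact (refSimplex n) := by
  have hc : IsClosed (refSimplex n) := by
    have h1 : refSimplex n = (⋂ i, {y : Fin n → ℝ | 0 ≤ y i}) ∩ {y | ∑ i, y i ≤ 1} := by
      ext y
      simp [refSimplex]
    rw [h1]
    exact (isClosed_iInter fun i => isClosed_le continuous_const (continuous_apply i)).inter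
      (isClosed_le (by fun_prop) continuous_const)
  refine (isCompact_univ_pi fun _ : Fin n => isCompact_Icc (a := (0 : ℝ)) (b := 1)).of_isClosed_subset
    hc fun y hy i _ => ⟨hy.1 i, ?_⟩
  exact (Finset.single_le_sum (fun j _ => hy.1 j) (Finset.mem_univ i)).trans hy.2

theorem continuous_refCoord (i : Fin (n + 1)) : Continuous fun y : Fin n → ℝ => refCoord y i := by
  refine Fin.cases ?_ (fun i => ?_) i
  · simp only [refCoord, Fin.cons_zero]; fun_prop
  · simp only [refCoord, Fin.cons_succ]; fun_prop

theorem sum_refCoord (y : Fin n → ℝ) : ∑ i, refCoord y i = 1 := by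
  simp [refCoord, Fin.sum_univ_succ]

theorem refCoord_nonneg {y : Fin n → ℝ} (hy : y ∈ refSimplex n) (i : Fin (n + 1)) :
    0 ≤ refCoord y i := by
  refine Fin.cases ?_ (fun i => ?_) i
  · simpa [refCoord] using hy.2
  · simpa [refCoord] using hy.1 i

theorem refCoord_tail {t : Fin (n + 1) → ℝ} (ht : ∑ i, t i = 1) : refCoord (Fin.tail t) = t := by
  rw [Fin.sum_univ_succ] at ht
  have h : 1 - ∑ i, Fin.tail t i = t 0 := by
    simp only [Fin.tail]
    linarith
  rw [refCoord, h, Fin.cons_self_tail]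

theorem mem_refSimplex_of_refCoord {y : Fin n → ℝ} (h : ∀ i, 0 ≤ refCoord y i) :
    y ∈ refSimplex n :=
  ⟨fun i => by simpa [refCoord] using h i.succ, by simpa [refCoord] using h 0⟩

theorem tail_mem_refSimplex {t : Fin (n + 1) → ℝ} (h0 : ∀ i, 0 ≤ t i) (ht : ∑ i, t i = 1) :
    Fin.tail t ∈ refSimplex n :=
  mem_refSimplex_of_refCoord fun i => by rw [refCoord_tail ht]; exact h0 i

/-- A nonnegative function with zero integral vanishes almost everywhere. Lebesgue measure charges
every nonempty open set, so by continuity `F` vanishes at every point of the open interior. -/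
theorem eq_zero_of_integral_refSimplex_eq_zero {F : (Fin n → ℝ) → ℝ} (hF : Continuous F)
    (h0 : ∀ y ∈ refSimplex n, 0 ≤ F y)
    (hi : ∫ y : refSimplex n, F y ∂(MeasureTheory.Measure.comap Subtype.val MeasureTheory.volume)
      = 0)
    {y : Fin n → ℝ} (hy : ∀ i, 0 < refCoord y i) : F y = 0 := by
  have hm : MeasurableSet (refSimplex n) := (isCompact_refSimplex n).measurableSet
  rw [MeasureTheory.integral_subtype_comap hm,
    MeasureTheory.setIntegral_eq_zero_iff_of_nonneg_ae
      ((MeasureTheory.ae_restrict_iff' hm).2 (Filter.Eventually.of_forall h0))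
      (hF.continuousOn.integrableOn_compact (isCompact_refSimplex n))] at hi
  have hsub : {y : Fin n → ℝ | ∀ i, 0 < refCoord y i} ⊆ refSimplex n := fun y hy =>
    mem_refSimplex_of_refCoord fun i => (hy i).le
  have hopen : IsOpen {y : Fin n → ℝ | ∀ i, 0 < refCoord y i} := by
    simp only [Set.ofPred_forall]
    exact isOpen_iInter_of_finite fun i => isOpen_lt continuous_const (continuous_refCoord i)
  exact MeasureTheory.Measure.eqOn_open_of_ae_eq
    (MeasureTheory.ae_restrict_of_ae_restrict_of_subset hsub hi) hopen hF.continuousOn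
    continuousOn_const hy

theorem integrable_refSimplex {F : refSimplex n → ℂ} (hF : Continuous F) :
    MeasureTheory.Integrable F
      (MeasureTheory.Measure.comap Subtype.val MeasureTheory.volume) := by
  have : CompactSpace (refSimplex n) := isCompact_iff_compactSpace.1 (isCompact_refSimplex n)
  have hm : MeasurableSet (refSimplex n) := (isCompact_refSimplex n).measurableSet
  have : MeasureTheory.IsFiniteMeasure (MeasureTheory.Measure.comap
      (Subtype.val : refSimplex n → Fin n → ℝ) MeasureTheory.volume) := by
    refine ⟨?_⟩
    rw [(MeasurableEmbedding.subtype_coe hm).comap_apply, Set.image_univ, Subtype.range_coe]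
    exact (isCompact_refSimplex n).measure_lt_top
  exact hF.integrable_of_hasCompactSupport (HasCompactSupport.of_compactSpace F)

end Reference

/-! ### Forms with continuous coefficients -/

section ContForms

variable {E : Type*} [NormedAddCommGroup E] [InnerProductSpace ℝ E] {n : ℕ}
  (T : Affine.Simplex ℝ E n)

/-- The forms that are continuous along the parametrization. -/
def contForms (k : ℕ) : Submodule ℂ (DForm T k) where
  carrier := {ω | ∀ v, Continuous fun y : refSimplex n => ω (param T y) v}
  add_mem' := fun ha hb v => (ha v).add (hb v)
  zero_mem' := fun _ => continuous_const
  smul_mem' := fun c _ ha v => (ha v).const_smul c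

variable {T}

theorem smul_mem_contForms {k : ℕ} {f : body T → ℂ} {ω : DForm T k}
    (hf : Continuous fun y => f (param T y)) (hω : ω ∈ contForms T k) :
    (fun x => f x • ω x) ∈ contForms T k :=
  fun v => hf.mul (hω v)

theorem dlam_mem_contForms (k : ℕ) (σ : Finset (Fin (n + 1))) : dlam T k σ ∈ contForms T k := by
  intro v
  simp only [dlam_apply]
  exact continuous_const

theorem continuous_lam (i : Fin (n + 1)) : Continuous fun y => lam T i (param T y) := by
  simp only [lam_param]
  exact Complex.continuous_ofReal.comp ((continuous_refCoord i).comp continuous_subtype_val)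

theorem continuous_lamPow (α : Fin (n + 1) → ℕ) : Continuous fun y => lamPow T α (param T y) :=
  continuous_finsetProd _ fun i _ => (continuous_lam i).pow _

theorem continuous_lamProd (σ : Finset (Fin (n + 1))) :
    Continuous fun y => lamProd T σ (param T y) :=
  continuous_finsetProd _ fun i _ => continuous_lam i

theorem whitney_mem_contForms (k : ℕ) (ρ : Finset (Fin (n + 1))) :
    whitney T k ρ ∈ contForms T k := by
  have h : whitney T k ρ
      = ∑ p ∈ ρ, fun x => (eps {p} (ρ.erase p) * lam T p x) • dlam T k (ρ.erase p) x := by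
    funext x
    rw [Finset.sum_apply]
    rfl
  rw [h]
  exact Submodule.sum_mem _ fun p _ =>
    smul_mem_contForms (continuous_const.mul (continuous_lam p)) (dlam_mem_contForms _ _)

theorem wedge_mem_contForms {k l : ℕ} {ω : DForm T k} {η : DForm T l} (hω : ω ∈ contForms T k)
    (hη : η ∈ contForms T l) : DForm.wedge ω η ∈ contForms T (k + l) := by
  intro v
  simp only [DForm.wedge, wedge_eq_sum]
  exact continuous_finsetSum _ fun s _ => continuous_const.mul ((hω _).mul (hη _))

theorem PLam_le_contForms (r k : ℕ) : PLam T r k ≤ contForms T k := by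
  refine Submodule.span_le.2 ?_
  rintro _ ⟨α, σ, -, -, rfl⟩
  exact smul_mem_contForms (continuous_lamPow α) (dlam_mem_contForms _ _)

theorem PMinusLam_le_contForms (r k : ℕ) : PMinusLam T r k ≤ contForms T k := by
  refine Submodule.span_le.2 ?_
  rintro _ ⟨α, σ, -, -, rfl⟩
  exact smul_mem_contForms (continuous_lamPow α) (whitney_mem_contForms _ _)

theorem integrable_of_mem_contForms {m : ℕ} (h : m = n) {ω : DForm T m}
    (hω : ω ∈ contForms T m) :
    MeasureTheory.Integrable
      (fun y : refSimplex n => ω (param T y) (fun j => edge T (Fin.cast h j)))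
      (MeasureTheory.Measure.comap Subtype.val MeasureTheory.volume) :=
  integrable_refSimplex (hω _)

/-- Additivity of the Bochner integral requires integrability, which follows here from continuity on
a compact set. This is the reason for carrying `contForms` along. -/
theorem integral_add {m : ℕ} (h : m = n) {ω η : DForm T m} (hω : ω ∈ contForms T m)
    (hη : η ∈ contForms T m) : integral T h (ω + η) = integral T h ω + integral T h η :=
  MeasureTheory.integral_add (integrable_of_mem_contForms h hω) (integrable_of_mem_contForms h hη)

theorem integral_smul {m : ℕ} (h : m = n) (c : ℂ) (ω : DForm T m) :
    integral T h (c • ω) = c * integral T h ω :=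
  MeasureTheory.integral_const_mul c _

theorem integral_sum {m : ℕ} (h : m = n) {ι : Type*} (s : Finset ι) (ω : ι → DForm T m)
    (hω : ∀ i ∈ s, ω i ∈ contForms T m) :
    integral T h (∑ i ∈ s, ω i) = ∑ i ∈ s, integral T h (ω i) := by
  classical
  induction s using Finset.induction_on with
  | empty =>
    rw [Finset.sum_empty, Finset.sum_empty]
    exact MeasureTheory.integral_zero _ _
  | insert i s hi ih =>
    rw [Finset.sum_insert hi, Finset.sum_insert hi, integral_add h
      (hω i (Finset.mem_insert_self i s))
      (Submodule.sum_mem _ fun j hj => hω j (Finset.mem_insert_of_mem hj)),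
      ih fun j hj => hω j (Finset.mem_insert_of_mem hj)]

theorem integral_congr {m : ℕ} (h : m = n) {ω η : DForm T m}
    (hωη : ∀ x, ω x (fun j => edge T (Fin.cast h j)) = η x fun j => edge T (Fin.cast h j)) :
    integral T h ω = integral T h η := by
  unfold integral
  simp only [hωη]

end ContForms

/-! ### The energy identity (1) and the equivalences (2) -/

section Pairing

variable {E : Type*} [NormedAddCommGroup E] [InnerProductSpace ℝ E] {n : ℕ}
  (T : Affine.Simplex ℝ E n) (r k : ℕ) (ω : (Fin (n + 1) → ℕ) → Finset (Fin (n + 1)) → ℂ)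

/-- The coefficient `∑_α ω_{ασ} t^α` of `dλ_σ`. -/
def coefEval (t : Fin (n + 1) → ℂ) (σ : Finset (Fin (n + 1))) : ℂ :=
  MvPolynomial.eval t (coefPoly r fun α => ω α σ)

theorem coefEval_lam (x : body T) (σ : Finset (Fin (n + 1))) :
    coefEval r ω (fun i => lam T i x) σ = ∑ α ∈ multiIndices r n, ω α σ * lamPow T α x :=
  eval_coefPoly _ _ _

/-- `D` acts on the index `σ` and evaluation on `α`, so they commute. Hence `Dc` at a point is the
value of a homogeneous polynomial with coefficients `Dω_α`. -/
theorem altD_coefEval (t : Fin (n + 1) → ℂ) (θ : Finset (Fin (n + 1))) :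
    altD (coefEval r ω t) θ = MvPolynomial.eval t (coefPoly r fun α => altD (ω α) θ) := by
  unfold altD coefEval
  simp only [eval_coefPoly, Finset.mul_sum, Finset.sum_mul, smul_eq_mul]
  rw [Finset.sum_comm]
  exact Finset.sum_congr rfl fun α _ => Finset.sum_congr rfl fun p _ => by ring

theorem altD_conj (b : Finset (Fin (n + 1)) → ℂ) (θ : Finset (Fin (n + 1))) :
    altD (fun σ => conj (b σ)) θ = conj (altD b θ) := by
  unfold altD
  rw [map_sum]
  exact Finset.sum_congr rfl fun p _ => by rw [smul_eq_mul, smul_eq_mul, map_mul, conj_eps]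

theorem conj_lam (i : Fin (n + 1)) (x : body T) : conj (lam T i x) = lam T i x :=
  Complex.conj_ofReal _

theorem conj_lamPow (α : Fin (n + 1) → ℕ) (x : body T) :
    conj (lamPow T α x) = lamPow T α x := by
  simp only [lamPow, map_prod, map_pow, conj_lam]

theorem coefEval_conj (x : body T) :
    coefEval r (fun α σ => conj (ω α σ)) (fun i => lam T i x)
      = fun σ => conj (coefEval r ω (fun i => lam T i x) σ) := by
  funext σ
  simp only [coefEval_lam, map_sum, map_mul, conj_lamPow]

theorem sum_smul_dlam_eq (x : body T) :
    ∑ α ∈ multiIndices r n, ∑ σ ∈ altIndices k n, (ω α σ * lamPow T α x) • dlam T k σ x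
      = ∑ σ ∈ altIndices k n, coefEval r ω (fun i => lam T i x) σ • dlam T k σ x := by
  rw [Finset.sum_comm]
  exact Finset.sum_congr rfl fun σ _ => by rw [coefEval_lam, Finset.sum_smul]

theorem sum_smul_whitney_eq (l : ℕ) (x : body T) :
    ∑ α ∈ multiIndices r n, ∑ σ ∈ altIndices k n,
      (eps σ σᶜ * ω α σ * lamPow T α x * lamProd T σ x) • whitney T l σᶜ x
      = ∑ σ ∈ altIndices k n, (eps σ σᶜ * coefEval r ω (fun i => lam T i x) σ * lamProd T σ x) •
          whitney T l σᶜ x := by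
  rw [Finset.sum_comm]
  refine Finset.sum_congr rfl fun σ _ => ?_
  rw [coefEval_lam, Finset.mul_sum, Finset.sum_mul, Finset.sum_smul]
  exact Finset.sum_congr rfl fun α _ => by rw [mul_assoc (eps σ σᶜ)]

/-- The form `∑ ω_{ασ} λ^α dλ_σ`. -/
def formOf : DForm T k :=
  fun x => ∑ α ∈ multiIndices r n, ∑ σ ∈ altIndices k n, (ω α σ * lamPow T α x) • dlam T k σ x

/-- The form `∑ ε(σ,σᶜ) ω_{ασ} λ^α λ_σ φ_{σᶜ}`. -/
def dualFormOf (l : ℕ) : DForm T l :=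
  fun x => ∑ α ∈ multiIndices r n, ∑ σ ∈ altIndices k n,
    (eps σ σᶜ * ω α σ * lamPow T α x * lamProd T σ x) • whitney T l σᶜ x

/-- The integrand of the pairing, as a function on the reference simplex. -/
def energy (y : Fin n → ℝ) : ℝ :=
  ∑ θ ∈ altIndices (k + 1) n, (∏ i ∈ θ, refCoord y i) *
    ‖altD (coefEval r ω fun i => (refCoord y i : ℂ)) θ‖ ^ 2

/-- The barycentric coordinates and the signs are real, so conjugating the coefficients conjugates
`Dc`, and `(Dc)_θ (Db)_θ` becomes `|(Dc)_θ|²`. -/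
theorem wedge_formOf_dualFormOf {l : ℕ} (h : k + l = n) (y : refSimplex n) :
    DForm.wedge (formOf T r k ω) (dualFormOf T r k (fun α σ => conj (ω α σ)) l) (param T y)
      (fun j => edge T (Fin.cast h j)) = (-1) ^ k * (energy r k ω y.1 : ℂ) := by
  have hl : (fun i => lam T i (param T y)) = fun i => ((refCoord y.1 i : ℝ) : ℂ) :=
    funext fun i => lam_param T i y
  rw [DForm.wedge, formOf, dualFormOf, sum_smul_dlam_eq, sum_smul_whitney_eq,
    wedge_sum_whitney_compl T h, energy, Complex.ofReal_sum, coefEval_conj]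
  congr 1
  refine Finset.sum_congr rfl fun θ _ => ?_
  rw [altD_conj, Complex.mul_conj, Complex.normSq_eq_norm_sq, hl, Complex.ofReal_mul, lamProd,
    Complex.ofReal_prod]
  simp only [lam_param]

theorem continuous_energy : Continuous (energy r k ω) := by
  unfold energy
  refine continuous_finsetSum _ fun θ _ => (continuous_finsetProd _ fun i _ =>
    continuous_refCoord i).mul (Continuous.pow (Continuous.norm ?_) 2)
  simp only [altD_coefEval, eval_coefPoly]
  exact continuous_finsetSum _ fun α _ => continuous_const.mul (continuous_finsetProd _ fun i _ =>
    (Complex.continuous_ofReal.comp (continuous_refCoord i)).pow _)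

theorem energy_nonneg {y : Fin n → ℝ} (hy : y ∈ refSimplex n) : 0 ≤ energy r k ω y :=
  Finset.sum_nonneg fun _ _ => mul_nonneg (Finset.prod_nonneg fun i _ => refCoord_nonneg hy i)
    (by positivity)

/-- Positive definiteness of the energy. -/
theorem altD_eq_zero_of_energy
    (h : ∀ y : Fin n → ℝ, (∀ i, 0 < refCoord y i) → energy r k ω y = 0) :
    ∀ α ∈ multiIndices r n, ∀ θ ∈ altIndices (k + 1) n, altD (ω α) θ = 0 := by
  intro α hα θ hθ
  have h1 : coefPoly r (fun α => altD (ω α) θ) = 0 := by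
    refine eq_zero_of_isHomogeneous (isHomogeneous_coefPoly _ _) fun t ht hs => ?_
    have hpos : ∀ i, 0 < refCoord (Fin.tail t) i := by rwa [refCoord_tail hs]
    have h2 := h (Fin.tail t) hpos
    -- All summands are nonnegative, so each is zero; at an interior point the weight `λ_θ` is
    -- positive and can be cancelled.
    rw [energy, Finset.sum_eq_zero_iff_of_nonneg fun _ _ => mul_nonneg
      (Finset.prod_nonneg fun i _ => (hpos i).le) (by positivity)] at h2
    have h3 := (mul_eq_zero.1 (h2 θ hθ)).resolve_left
      (Finset.prod_pos fun i _ => hpos i).ne'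
    rw [sq_eq_zero_iff, norm_eq_zero, altD_coefEval, refCoord_tail hs] at h3
    exact h3
  rw [← coeff_coefPoly (fun α => altD (ω α) θ) hα, h1, MvPolynomial.coeff_zero]

theorem altD_coefEval_eq_zero
    (h : ∀ α ∈ multiIndices r n, ∀ θ ∈ altIndices (k + 1) n, altD (ω α) θ = 0)
    (t : Fin (n + 1) → ℂ) (θ : Finset (Fin (n + 1))) (hθ : θ.card = k + 1) :
    altD (coefEval r ω t) θ = 0 := by
  rw [altD_coefEval, eval_coefPoly]
  exact Finset.sum_eq_zero fun α hα => by
    rw [h α hα θ (Finset.mem_powersetCard_univ.2 hθ), zero_mul]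

theorem formOf_eq_zero
    (h : ∀ α ∈ multiIndices r n, ∀ θ ∈ altIndices (k + 1) n, altD (ω α) θ = 0) :
    formOf T r k ω = 0 := by
  funext x
  ext v
  rw [formOf, sum_smul_dlam_eq, alternatingMap_sum_smul_apply]
  simp only [dlam_apply]
  exact sum_mul_minor_eq_zero _ (sum_rows T k v) _ (altD_coefEval_eq_zero r k ω h _)

theorem dualFormOf_eq_zero (l : ℕ)
    (h : ∀ α ∈ multiIndices r n, ∀ θ ∈ altIndices (k + 1) n, altD (ω α) θ = 0) :
    dualFormOf T r k ω l = 0 := by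
  funext x
  rw [dualFormOf, sum_smul_whitney_eq, sum_whitney_compl]
  refine Finset.sum_eq_zero fun θ hθ => ?_
  rw [altD_coefEval_eq_zero r k ω h _ θ (Finset.mem_powersetCard_univ.1 hθ), mul_zero, zero_mul,
    zero_smul]

/-- A pointwise criterion, with no integration: it serves the case where one factor is known to be
the zero form. -/
theorem energy_eq_zero_of_wedge {l : ℕ} (h : k + l = n)
    (hw : DForm.wedge (formOf T r k ω) (dualFormOf T r k (fun α σ => conj (ω α σ)) l) = 0)
    (y : Fin n → ℝ) (hy : ∀ i, 0 < refCoord y i) : energy r k ω y = 0 := by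
  have hmem := mem_refSimplex_of_refCoord fun i => (hy i).le
  have h1 := wedge_formOf_dualFormOf T r k ω h ⟨y, hmem⟩
  rw [hw] at h1
  have h2 := (mul_eq_zero.1 h1.symm).resolve_left (by simp)
  exact_mod_cast h2

theorem pairingSum_eq_integral (hk : k ≤ n) :
    pairingSum T r k hk ω = integral T (Nat.add_sub_of_le hk)
      (DForm.wedge (formOf T r k ω) (dualFormOf T r k (fun α σ => conj (ω α σ)) (n - k))) := by
  have hmem : ∀ α β σ ρ, DForm.wedge (fun x => (ω α σ * lamPow T α x) • dlam T k σ x)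
          (fun x => (eps ρ ρᶜ * conj (ω β ρ) * lamPow T β x * lamProd T ρ x) •
            whitney T (n - k) ρᶜ x) ∈ contForms T (k + (n - k)) := by
    intro α β σ ρ
    exact wedge_mem_contForms
      (smul_mem_contForms (continuous_const.mul (continuous_lamPow α)) (dlam_mem_contForms _ _))
      (smul_mem_contForms ((continuous_const.mul (continuous_lamPow β)).mul (continuous_lamProd ρ))
        (whitney_mem_contForms _ _))
  have hw : DForm.wedge (formOf T r k ω) (dualFormOf T r k (fun α σ => conj (ω α σ)) (n - k))
      = ∑ α ∈ multiIndices r n, ∑ β ∈ multiIndices r n,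
        ∑ σ ∈ altIndices k n, ∑ ρ ∈ altIndices k n,
          DForm.wedge (fun x => (ω α σ * lamPow T α x) • dlam T k σ x)
          (fun x => (eps ρ ρᶜ * conj (ω β ρ) * lamPow T β x * lamProd T ρ x) •
            whitney T (n - k) ρᶜ x) := by
    funext x
    simp only [Finset.sum_apply, DForm.wedge, ← wedgeBilin_apply, formOf, dualFormOf, map_sum,
      LinearMap.sum_apply]
    conv_rhs => rw [Finset.sum_comm]
    refine Finset.sum_congr rfl fun β _ => ?_
    rw [Finset.sum_comm]
    exact Finset.sum_congr rfl fun α _ => Finset.sum_comm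
  rw [hw, pairingSum, integral_sum _ _ _ fun α _ => Submodule.sum_mem _ fun β _ =>
    Submodule.sum_mem _ fun σ _ => Submodule.sum_mem _ fun ρ _ => hmem α β σ ρ]
  refine Finset.sum_congr rfl fun α _ => ?_
  rw [integral_sum _ _ _ fun β _ =>
    Submodule.sum_mem _ fun σ _ => Submodule.sum_mem _ fun ρ _ => hmem α β σ ρ]
  refine Finset.sum_congr rfl fun β _ => ?_
  rw [integral_sum _ _ _ fun σ _ => Submodule.sum_mem _ fun ρ _ => hmem α β σ ρ]
  refine Finset.sum_congr rfl fun σ _ => ?_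
  rw [integral_sum _ _ _ fun ρ _ => hmem α β σ ρ]

theorem integral_wedge_formOf_dualFormOf {l : ℕ} (h : k + l = n) :
    integral T h (DForm.wedge (formOf T r k ω) (dualFormOf T r k (fun α σ => conj (ω α σ)) l))
      = (-1) ^ k * ((∫ y : refSimplex n, energy r k ω y
        ∂(MeasureTheory.Measure.comap Subtype.val MeasureTheory.volume) : ℝ) : ℂ) := by
  rw [integral]
  simp only [wedge_formOf_dualFormOf T r k ω h]
  rw [MeasureTheory.integral_const_mul, integral_complex_ofReal]

theorem sum_integral_whitneyTop :
    ∑ θ ∈ altIndices (k + 1) n, integral T rfl (fun x =>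
      (lamProd T θ x * (‖∑ α ∈ multiIndices r n, ∑ p ∈ θ,
        eps {p} (θ.erase p) * lamPow T α x * ω α (θ.erase p)‖ ^ 2 : ℝ)) • whitneyTop T x)
      = ((∫ y : refSimplex n, energy r k ω y
        ∂(MeasureTheory.Measure.comap Subtype.val MeasureTheory.volume) : ℝ) : ℂ) := by
  have h1 : ∀ θ x, ∑ α ∈ multiIndices r n, ∑ p ∈ θ,
      eps {p} (θ.erase p) * lamPow T α x * ω α (θ.erase p)
      = altD (coefEval r ω fun i => lam T i x) θ := by
    intro θ x
    rw [altD_coefEval, eval_coefPoly]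
    refine Finset.sum_congr rfl fun α _ => ?_
    rw [altD, Finset.sum_mul]
    exact Finset.sum_congr rfl fun p _ => by rw [smul_eq_mul, lamPow]; ring
  rw [← integral_complex_ofReal, ← integral_sum]
  · unfold integral
    congr 1
    funext y
    have hl : (fun i => lam T i (param T y)) = fun i => ((refCoord y.1 i : ℝ) : ℂ) :=
      funext fun i => lam_param T i y
    rw [Finset.sum_apply, alternatingMap_sum_smul_apply _ _ fun _ => whitneyTop T (param T y),
      energy, Complex.ofReal_sum]
    refine Finset.sum_congr rfl fun θ _ => ?_
    rw [whitneyTop_edge, mul_one, h1, hl, Complex.ofReal_mul, lamProd, Complex.ofReal_prod]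
    simp only [lam_param]
  · intro θ _
    refine smul_mem_contForms ((continuous_lamProd θ).mul (Complex.continuous_ofReal.comp
      (Continuous.pow (Continuous.norm ?_) 2))) (whitney_mem_contForms _ _)
    exact continuous_finsetSum _ fun α _ => continuous_finsetSum _ fun p _ =>
      (continuous_const.mul (continuous_lamPow α)).mul continuous_const

theorem altD_eq_zero_of_pairingSum (hk : k ≤ n) (h : pairingSum T r k hk ω = 0) :
    ∀ α ∈ multiIndices r n, ∀ θ ∈ altIndices (k + 1) n, altD (ω α) θ = 0 := by
  rw [pairingSum_eq_integral, integral_wedge_formOf_dualFormOf] at h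
  have h1 := (mul_eq_zero.1 h).resolve_left (by simp)
  exact altD_eq_zero_of_energy r k ω fun y hy => eq_zero_of_integral_refSimplex_eq_zero
    (continuous_energy r k ω) (fun y hy => energy_nonneg r k ω hy) (by exact_mod_cast h1) hy

/-- Condition (v) is the hub: it closes the cycle (i), (v), (ii), and is equivalent to (iii) and to
(iv) separately. -/
theorem tfae_pairing (hk : k ≤ n) : List.TFAE [
    pairingSum T r k hk ω = 0,
    formOf T r k ω = 0,
    dualFormOf T r k ω (n - k) = 0,
    ∀ α ∈ multiIndices r n, ∀ σ ∈ altIndices k n, 0 ∉ σ →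
      ω α σ - ∑ p ∈ σ, eps {p} (σ.erase p) * ω α (insert 0 (σ.erase p)) = 0,
    ∀ α ∈ multiIndices r n, ∀ θ ∈ altIndices (k + 1) n,
      ∑ p ∈ θ, eps {p} (θ.erase p) * ω α (θ.erase p) = 0] := by
  tfae_have 1 → 5 := altD_eq_zero_of_pairingSum T r k ω hk
  tfae_have 5 → 2 := formOf_eq_zero T r k ω
  tfae_have 5 → 3 := dualFormOf_eq_zero T r k ω (n - k)
  tfae_have 2 → 1 := by
    intro h
    rw [pairingSum_eq_integral, h, integral_congr (η := 0), integral]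
    · exact MeasureTheory.integral_zero _ _
    · intro x
      simp only [DForm.wedge, Pi.zero_apply, ← wedgeBilin_apply, map_zero, LinearMap.zero_apply]
  tfae_have 3 → 5 := by
    intro h α hα θ hθ
    -- The vanishing dual form has coefficients `ω`, so its partner must have coefficients `conj ω`.
    -- This yields `D (conj ω_α) = 0`, and conjugation commutes with `D`.
    have hw : DForm.wedge (formOf T r k fun α σ => conj (ω α σ))
        (dualFormOf T r k (fun α σ => conj (conj (ω α σ))) (n - k)) = 0 := by
      simp only [Complex.conj_conj]
      rw [h]
      funext x
      simp only [DForm.wedge, Pi.zero_apply, ← wedgeBilin_apply, map_zero]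
    have h1 := altD_eq_zero_of_energy r k _
      (energy_eq_zero_of_wedge T r k _ (Nat.add_sub_of_le hk) hw) α hα θ hθ
    rw [altD_conj, map_eq_zero] at h1
    exact h1
  tfae_have 4 ↔ 5 := by
    refine forall₂_congr fun α hα => ?_
    have h1 := altD_eq_zero_iff (ω α) k
    simp only [Finset.mem_powersetCard_univ]
    exact h1.symm
  tfae_finish

end Pairing

/-! ### Divisibility of homogeneous polynomials that vanish on facets -/

section Divisibility

open MvPolynomial

variable {n : ℕ}

/-- The monomials without `X i` form the remainder modulo `X i`, which is the restriction of `p` to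
the hyperplane of the facet. By homogeneity this restriction vanishes at all nonnegative points of
the hyperplane, hence identically. -/
theorem coeff_eq_zero_of_vanishes_on_facet {s : ℕ} (hs : s ≠ 0)
    {p : MvPolynomial (Fin (n + 1)) ℂ} (hp : p.IsHomogeneous s) {i : Fin (n + 1)}
    (h : ∀ t : Fin (n + 1) → ℝ, (∀ j, 0 ≤ t j) → ∑ j, t j = 1 → t i = 0 →
      eval (fun j => (t j : ℂ)) p = 0) {d : Fin (n + 1) →₀ ℕ} (hd : d i = 0) :
    coeff d p = 0 := by
  have hle : ∀ e : Fin (n + 1) →₀ ℕ, e i ≠ 0 → Finsupp.single i 1 ≤ e := fun e he => by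
    rw [Finsupp.single_le_iff]; omega
  have hp0 : ∀ t : Fin (n + 1) → ℝ, (∀ j, 0 ≤ t j) → t i = 0 →
      eval (fun j => (t j : ℂ)) p = 0 := by
    intro t ht hti
    -- The origin cannot be rescaled into the simplex; there `s ≠ 0` gives the value zero. For `n =
    -- 0` the facet is empty and the origin is the only point to consider.
    rcases (Finset.sum_nonneg fun j _ => ht j : 0 ≤ ∑ j, t j).eq_or_lt with hS | hS
    · have h0 : ∀ j, t j = 0 := fun j =>
        (Finset.sum_eq_zero_iff_of_nonneg fun j _ => ht j).1 hS.symm j (Finset.mem_univ j)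
      have h1 := eval_smul_of_isHomogeneous hp 0 fun j => (t j : ℂ)
      rw [zero_pow hs, zero_mul] at h1
      simpa [h0] using h1
    · have h1 := h (fun j => (∑ j, t j)⁻¹ * t j) (fun j => mul_nonneg (inv_pos.2 hS).le (ht j))
        (by rw [← Finset.mul_sum, inv_mul_cancel₀ hS.ne']) (by rw [hti, mul_zero])
      simp only [Complex.ofReal_mul] at h1
      rw [eval_smul_of_isHomogeneous hp] at h1
      refine (mul_eq_zero.1 h1).resolve_left (pow_ne_zero _ ?_)
      exact_mod_cast (inv_pos.2 hS).ne'
  have hmod : p.modMonomial (Finsupp.single i 1) = 0 := by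
    refine eq_zero_of_eval_pos fun t ht => ?_
    -- The remainder does not involve `X i`, so its value is unchanged when `t i` is set to `0`.
    have h1 : eval (fun j => (t j : ℂ)) (p.modMonomial (Finsupp.single i 1))
        = eval (fun j => ((Function.update t i 0 j : ℝ) : ℂ))
          (p.modMonomial (Finsupp.single i 1)) := by
      rw [eval_eq', eval_eq']
      refine Finset.sum_congr rfl fun e he => ?_
      have hei : e i = 0 := by
        by_contra hne
        exact mem_support_iff.1 he (coeff_modMonomial_of_le _ (hle e hne))
      congr 1
      refine Finset.prod_congr rfl fun j _ => ?_
      rcases eq_or_ne j i with rfl | hj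
      · rw [hei, pow_zero, pow_zero]
      · rw [Function.update_of_ne hj]
    have h2 := congrArg (eval fun j => ((Function.update t i 0 j : ℝ) : ℂ))
      (divMonomial_add_modMonomial_single p i)
    rw [map_add, map_mul, eval_X, Function.update_self, Complex.ofReal_zero, zero_mul, zero_add,
      hp0 (Function.update t i 0) (fun j => by
        rcases eq_or_ne j i with rfl | hj
        · rw [Function.update_self]
        · rw [Function.update_of_ne hj]; exact (ht j).le) (Function.update_self ..)] at h2
    rw [h1, h2]
  rw [← coeff_modMonomial_of_not_le (s := Finsupp.single i 1) p, hmod, coeff_zero]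
  rw [Finsupp.single_le_iff, hd]
  omega

/-- Each monomial that occurs in `p` contains every `X i` with `i ∈ S`, hence is a multiple of the
squarefree monomial with exponent `e`. One division by that monomial suffices. -/
theorem exists_eq_prod_X_mul {r : ℕ} {S : Finset (Fin (n + 1))} (hS : S.card + r ≠ 0)
    {p : MvPolynomial (Fin (n + 1)) ℂ} (hp : p.IsHomogeneous (S.card + r))
    (h : ∀ i ∈ S, ∀ t : Fin (n + 1) → ℝ, (∀ j, 0 ≤ t j) → ∑ j, t j = 1 → t i = 0 →
      eval (fun j => (t j : ℂ)) p = 0) :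
    ∃ q : MvPolynomial (Fin (n + 1)) ℂ, q.IsHomogeneous r ∧ p = (∏ i ∈ S, X i) * q := by
  set e : Fin (n + 1) →₀ ℕ := ∑ i ∈ S, Finsupp.single i 1 with he
  have hej : ∀ j, e j = if j ∈ S then 1 else 0 := by
    intro j
    rw [he, Finsupp.finsetSum_apply]
    simp [Finsupp.single_apply]
  have hprod : (∏ i ∈ S, X i : MvPolynomial (Fin (n + 1)) ℂ) = monomial e 1 := by
    rw [he, monomial_sum_one]
    rfl
  have hmod : p.modMonomial e = 0 := by
    ext d
    rw [coeff_zero]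
    by_cases hed : e ≤ d
    · exact coeff_modMonomial_of_le _ hed
    · rw [coeff_modMonomial_of_not_le _ hed]
      obtain ⟨i, hi⟩ : ∃ i, ¬ e i ≤ d i := by
        by_contra! hcon
        exact hed hcon
      rw [hej] at hi
      split_ifs at hi with hiS
      · exact coeff_eq_zero_of_vanishes_on_facet hS hp (h i hiS) (by omega)
      · omega
  refine ⟨p.divMonomial e, ?_, ?_⟩
  · intro d hd
    rw [coeff_divMonomial] at hd
    have h1 := hp hd
    have hw : ∀ x : Fin (n + 1) →₀ ℕ, Finsupp.weight 1 x = x.degree := fun x =>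
      (DFunLike.congr_fun Finsupp.degree_eq_weight_one x).symm
    rw [hw] at h1 ⊢
    have h2 : Finsupp.degree e = S.card := by
      rw [Finsupp.degree_eq_sum]
      simp [hej]
    rw [map_add, h2] at h1
    omega
  · have h1 := divMonomial_add_modMonomial p e
    rw [hmod, add_zero] at h1
    rw [hprod, h1]

end Divisibility

/-! ### Exactness with polynomial coefficients -/

section Exactness

variable {n : ℕ} {A : Type*} [CommRing A] [Algebra ℂ A]

/-- The minus sign is a parity difference: one side moves `p` past `θ - p`, the other moves `0` past
all of `θ`, which has one more element. -/
theorem eps_cone_sign {μ θ : Finset (Fin (n + 1))} (h0 : 0 ∉ θ) (hμ : μ = (insert 0 θ)ᶜ)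
    {p : Fin (n + 1)} (hp : p ∈ θ) :
    eps {p} (θ.erase p) * eps (insert 0 (θ.erase p)) (insert 0 (θ.erase p))ᶜ
      = -(eps θ θᶜ * eps {p} μ) := by
  have hp0 : p ≠ 0 := fun e => h0 (e ▸ hp)
  have h0e : (0 : Fin (n + 1)) ∉ θ.erase p := fun h => h0 (Finset.mem_of_mem_erase h)
  have h0μ : (0 : Fin (n + 1)) ∉ μ := by simp [hμ]
  have hpμ : p ∉ μ := by simp [hμ, hp]
  have e1 : θᶜ = insert 0 μ := by
    rw [hμ, Finset.compl_insert, Finset.insert_erase (by simpa using h0)]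
  have e2 : (insert 0 (θ.erase p))ᶜ = insert p μ := by
    rw [hμ, ← Finset.erase_insert_of_ne hp0.symm, Finset.compl_erase]
  have e3 : eps θ μ = eps {p} μ * eps (θ.erase p) μ := by
    rw [← eps_insert_left _ (Finset.notMem_erase p θ), Finset.insert_erase hp]
  have hc : θ.card = (θ.erase p).card + 1 := (Finset.card_erase_add_one hp).symm
  have h0p : eps {0} {p} = 1 := eps_zero_left (by simpa using hp0.symm)
  rw [e1, e2, eps_insert_left _ h0e, eps_insert_right _ hpμ, eps_insert_right _ hpμ,
    eps_insert_right _ h0μ, eps_singleton_right h0, eps_zero_left h0, eps_zero_left h0μ, h0p,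
    eps_singleton_right (Finset.notMem_erase p θ), e3, hc, pow_succ]
  linear_combination ((-1) ^ (θ.erase p).card * eps (θ.erase p) μ) *
    (eps_mul_self {p} (θ.erase p) - eps_mul_self {p} μ)

/-- The cone over the vertex `0` exhibits a cocycle of the dual complex as an alternating
difference. -/
theorem altD_cone (k : ℕ) (h : Finset (Fin (n + 1)) → A)
    (hh : ∀ μ : Finset (Fin (n + 1)), μ.card + (k + 1) = n →
      ∑ p ∈ μᶜ, eps {p} μ • h (insert p μ) = 0)
    (θ : Finset (Fin (n + 1))) (hθ : θ.card = k + 1) :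
    altD (fun σ => if 0 ∈ σ then 0 else eps (insert 0 σ) (insert 0 σ)ᶜ • h (insert 0 σ)ᶜ) θ
      = eps θ θᶜ • h θᶜ := by
  unfold altD
  by_cases h0 : 0 ∈ θ
  -- For `p ≠ 0` the set `θ - p` still contains `0`, where the cone is zero.
  · rw [Finset.sum_eq_single_of_mem 0 h0]
    · rw [eps_zero_left (Finset.notMem_erase _ _), one_smul]
      simp only [Finset.notMem_erase, if_false, Finset.insert_erase h0]
    · intro p hp hp0
      simp only [Finset.mem_erase.2 ⟨hp0.symm, h0⟩, if_true, smul_zero]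
  -- If `0 ∉ θ`, the cocycle relation at `μ` trades the sum over `p ∈ θ` for its remaining term, `h`
  -- at `insert 0 μ = θᶜ`.
  · set μ := (insert 0 θ)ᶜ with hμ
    have hμc : μᶜ = insert 0 θ := compl_compl _
    have h0μ : (0 : Fin (n + 1)) ∉ μ := by simp [hμ]
    have hcard : μ.card + (k + 1) = n := by
      have := Finset.card_le_univ (insert 0 θ)
      rw [hμ, Finset.card_compl, Finset.card_insert_of_notMem h0, Fintype.card_fin, hθ]
      rw [Finset.card_insert_of_notMem h0, Fintype.card_fin, hθ] at this
      omega
    have h1 := hh μ hcard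
    rw [hμc, Finset.sum_insert h0, eps_zero_left h0μ, one_smul] at h1
    have e1 : θᶜ = insert 0 μ := by
      rw [hμ, Finset.compl_insert, Finset.insert_erase (by simpa using h0)]
    have h2 : ∀ p ∈ θ, eps {p} (θ.erase p) • (if 0 ∈ θ.erase p then (0 : A) else
        eps (insert 0 (θ.erase p)) (insert 0 (θ.erase p))ᶜ • h (insert 0 (θ.erase p))ᶜ)
        = -(eps θ θᶜ • (eps {p} μ • h (insert p μ))) := by
      intro p hp
      have hp0 : p ≠ 0 := fun e => h0 (e ▸ hp)
      have e2 : (insert 0 (θ.erase p))ᶜ = insert p μ := by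
        rw [hμ, ← Finset.erase_insert_of_ne hp0.symm, Finset.compl_erase]
      rw [if_neg fun h => h0 (Finset.mem_of_mem_erase h), smul_smul, smul_smul,
        eps_cone_sign h0 hμ hp, e2, neg_smul]
    rw [Finset.sum_congr rfl h2, Finset.sum_neg_distrib, ← Finset.smul_sum,
      eq_neg_of_add_eq_zero_right h1, smul_neg, neg_neg, e1]

end Exactness

/-! ### Traces -/

section Trace

variable {E : Type*} [NormedAddCommGroup E] [InnerProductSpace ℝ E] {n : ℕ}
  (T : Affine.Simplex ℝ E n)

theorem ne_orderEmbOfFin {m : ℕ} {fs : Finset (Fin (n + 1))} (h : fs.card = m) {i : Fin (n + 1)}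
    (hi : i ∉ fs) (a : Fin m) : i ≠ fs.orderEmbOfFin h a :=
  fun e => hi (e ▸ Finset.orderEmbOfFin_mem fs h a)

/-- The tangent space of the face is spanned by differences of its vertices, and `λ_i` is zero at
all of these. -/
theorem dlamOne_face {m : ℕ} {fs : Finset (Fin (n + 1))} (h : fs.card = m + 1) {i : Fin (n + 1)}
    (hi : i ∉ fs) {w : E} (hw : w ∈ tangent (T.face h)) (hw' : w ∈ tangent T) :
    dlamOne T i ⟨w, hw'⟩ = 0 := by
  rw [tangent, direction_affineSpan, vectorSpan_def] at hw
  have key : ∀ z ∈ Submodule.span ℝ (Set.range (T.face h).points -ᵥ Set.range (T.face h).points),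
      ∃ hz : z ∈ tangent T, dlamOne T i ⟨z, hz⟩ = 0 := by
    intro z hz
    induction hz using Submodule.span_induction with
    | mem z hz =>
      obtain ⟨_, ⟨a, rfl⟩, _, ⟨b, rfl⟩, rfl⟩ := hz
      rw [Affine.Simplex.face_points, Affine.Simplex.face_points]
      refine ⟨points_sub_mem T _ _, ?_⟩
      refine (dlamOne_points_sub T i _ _).trans ?_
      rw [if_neg (ne_orderEmbOfFin h hi a), if_neg (ne_orderEmbOfFin h hi b), sub_zero]
    | zero => exact ⟨zero_mem _, map_zero (dlamOne T i)⟩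
    | add x y _ _ hx hy =>
      obtain ⟨hx1, hx2⟩ := hx
      obtain ⟨hy1, hy2⟩ := hy
      refine ⟨add_mem hx1 hy1, ?_⟩
      have := map_add (dlamOne T i) ⟨x, hx1⟩ ⟨y, hy1⟩
      rw [hx2, hy2, add_zero] at this
      exact this
    | smul c x _ hx =>
      obtain ⟨hx1, hx2⟩ := hx
      refine ⟨Submodule.smul_mem _ c hx1, ?_⟩
      have := map_smul (dlamOne T i) c ⟨x, hx1⟩
      rw [hx2, smul_zero] at this
      exact this
  exact (key w hw).2

theorem lam_face {m : ℕ} {fs : Finset (Fin (n + 1))} (h : fs.card = m + 1) {i : Fin (n + 1)}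
    (hi : i ∉ fs) {x : E} (hx : x ∈ body (T.face h)) (hx' : x ∈ body T) :
    lam T i ⟨x, hx'⟩ = 0 := by
  have hmem : x - T.points (fs.orderEmbOfFin h 0) ∈ tangent (T.face h) := by
    rw [← Affine.Simplex.face_points]
    exact AffineSubspace.vsub_mem_direction (convexHull_subset_affineSpan _ hx)
      (points_mem (T.face h) 0)
  have hmem' : x - T.points (fs.orderEmbOfFin h 0) ∈ tangent T :=
    AffineSubspace.direction_le (T.affineSpan_face_le h) hmem
  rw [lam_eq T i (fs.orderEmbOfFin h 0) ⟨x, hx'⟩ hmem', dlamOne_face T h hi hmem hmem',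
    if_neg (ne_orderEmbOfFin h hi 0), add_zero]

/-- In the expansion into terms `λ_θ dλ_{θᶜ}`, a vertex `i` missing from the face lies either in
`θ`, where `λ_i = 0` on the face, or in `θᶜ`, where `dλ_i = 0` along it. -/
theorem trace_dualFormOf (r k l : ℕ) (ω : (Fin (n + 1) → ℕ) → Finset (Fin (n + 1)) → ℂ)
    {m : ℕ} {fs : Finset (Fin (n + 1))} (h : fs.card = m + 1) (hfs : fs ≠ Finset.univ) :
    trace T h (dualFormOf T r k ω l) = 0 := by
  obtain ⟨i, hi⟩ : ∃ i, i ∉ fs := by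
    by_contra! hcon
    exact hfs (Finset.eq_univ_of_forall hcon)
  funext x
  ext v
  rw [trace, AlternatingMap.compLinearMap_apply, dualFormOf, sum_smul_whitney_eq, sum_whitney_compl,
    alternatingMap_sum_smul_apply]
  refine Finset.sum_eq_zero fun θ _ => ?_
  by_cases hiθ : i ∈ θ
  · rw [lamProd, Finset.prod_eq_zero hiθ (lam_face T h hi x.2 _)]
    ring
  · rw [dlam_apply, minor_eq_zero_of_row _ (Finset.mem_compl.2 hiθ), mul_zero]
    funext j
    exact dlamOne_face T h hi (v j).2 _

theorem dualFormOf_mem {r k : ℕ} (hk : k ≤ n)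
    (ω : (Fin (n + 1) → ℕ) → Finset (Fin (n + 1)) → ℂ) :
    dualFormOf T r k ω (n - k) ∈ PMinusLamZero T (r + k + 1) (n - k) := by
  refine ⟨?_, fun m fs h hfs => trace_dualFormOf T r k _ ω h hfs⟩
  have h1 : dualFormOf T r k ω (n - k) = ∑ α ∈ multiIndices r n, ∑ σ ∈ altIndices k n,
      -- Absorbing `λ_σ` into the monomial raises the degree to `r + k`, one less than the index of
      -- the space, as `PMinusLam` demands.
      (eps σ σᶜ * ω α σ) • (fun x => lamPow T (fun i => α i + if i ∈ σ then 1 else 0) x •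
        whitney T (n - k) σᶜ x : DForm T (n - k)) := by
    funext x
    simp only [dualFormOf, Finset.sum_apply, Pi.smul_apply, smul_smul]
    refine Finset.sum_congr rfl fun α _ => Finset.sum_congr rfl fun σ _ => ?_
    congr 1
    simp only [lamPow, lamProd, pow_add, Finset.prod_mul_distrib, pow_ite, pow_one, pow_zero]
    rw [Finset.prod_ite_mem, Finset.univ_inter, mul_assoc, mul_assoc]
  rw [h1]
  refine Submodule.sum_mem _ fun α hα => Submodule.sum_mem _ fun σ hσ =>
    Submodule.smul_mem _ _ (Submodule.subset_span ⟨_, σᶜ, ?_, ?_, rfl⟩)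
  · rw [Finset.sum_add_distrib, mem_multiIndices.1 hα, Finset.sum_ite_mem, Finset.univ_inter,
      Finset.sum_const, Finset.mem_powersetCard_univ.1 hσ, smul_eq_mul, mul_one]
  · rw [Finset.card_compl, Fintype.card_fin, Finset.mem_powersetCard_univ.1 hσ]
    omega

theorem formOf_mem (r k : ℕ) (ω : (Fin (n + 1) → ℕ) → Finset (Fin (n + 1)) → ℂ) :
    formOf T r k ω ∈ PLam T r k := by
  have h1 : formOf T r k ω = ∑ α ∈ multiIndices r n, ∑ σ ∈ altIndices k n,
      ω α σ • (fun x => lamPow T α x • dlam T k σ x : DForm T k) := by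
    funext x
    simp only [formOf, Finset.sum_apply, Pi.smul_apply, smul_smul]
  rw [h1]
  exact Submodule.sum_mem _ fun α hα => Submodule.sum_mem _ fun σ hσ =>
    Submodule.smul_mem _ _ (Submodule.subset_span
      ⟨α, σ, mem_multiIndices.1 hα, Finset.mem_powersetCard_univ.1 hσ, rfl⟩)

theorem exists_eq_formOf {r k : ℕ} {η : DForm T k} (hη : η ∈ PLam T r k) :
    ∃ ω, η = formOf T r k ω := by
  induction hη using Submodule.span_induction with
  | mem η hη =>
    obtain ⟨α, σ, hα, hσ, rfl⟩ := hη
    refine ⟨fun β ρ => if β = α then (if ρ = σ then 1 else 0) else 0, ?_⟩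
    funext x
    rw [formOf, Finset.sum_eq_single_of_mem α (mem_multiIndices.2 hα),
      Finset.sum_eq_single_of_mem σ (Finset.mem_powersetCard_univ.2 hσ)]
    · simp
    · intro ρ _ hρ
      simp [hρ]
    · intro β _ hβ
      simp [hβ]
  | zero =>
    refine ⟨0, ?_⟩
    funext x
    simp [formOf]
  | add a b _ _ ha hb =>
    obtain ⟨ω, rfl⟩ := ha
    obtain ⟨ω', rfl⟩ := hb
    refine ⟨ω + ω', ?_⟩
    funext x
    simp only [formOf, Pi.add_apply, add_mul, add_smul, Finset.sum_add_distrib]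
  | smul c a _ ha =>
    obtain ⟨ω, rfl⟩ := ha
    refine ⟨c • ω, ?_⟩
    funext x
    simp only [formOf, Pi.smul_apply, Finset.smul_sum, smul_smul, smul_eq_mul, mul_assoc]

end Trace

/-! ### Every form with vanishing traces is a dual form -/

section Spanning

open MvPolynomial

variable {E : Type*} [NormedAddCommGroup E] [InnerProductSpace ℝ E] {n : ℕ}
  (T : Affine.Simplex ℝ E n)

theorem eval_const_smul (c : ℂ) (t : Fin (n + 1) → ℂ) (p : MvPolynomial (Fin (n + 1)) ℂ) :
    eval t (c • p) = c • eval t p := by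
  rw [smul_eval, smul_eq_mul]

theorem eval_altK (t : Fin (n + 1) → ℂ) (f : Finset (Fin (n + 1)) → MvPolynomial (Fin (n + 1)) ℂ)
    (μ : Finset (Fin (n + 1))) :
    eval t (altK X f μ) = altK t (fun σ => eval t (f σ)) μ := by
  simp only [altK, map_sum, eval_const_smul, map_mul, eval_X]

theorem eval_altD (t : Fin (n + 1) → ℂ) (f : Finset (Fin (n + 1)) → MvPolynomial (Fin (n + 1)) ℂ)
    (θ : Finset (Fin (n + 1))) :
    eval t (altD f θ) = altD (fun σ => eval t (f σ)) θ := by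
  simp only [altD, map_sum, eval_const_smul]

theorem isHomogeneous_smul {p : MvPolynomial (Fin (n + 1)) ℂ} {s : ℕ} (hp : p.IsHomogeneous s)
    (c : ℂ) : (c • p).IsHomogeneous s := by
  rw [smul_eq_C_mul]
  exact hp.C_mul c

theorem isHomogeneous_altK {f : Finset (Fin (n + 1)) → MvPolynomial (Fin (n + 1)) ℂ} {s : ℕ}
    (hf : ∀ ρ, (f ρ).IsHomogeneous s) (μ : Finset (Fin (n + 1))) :
    (altK X f μ).IsHomogeneous (s + 1) := by
  refine IsHomogeneous.sum _ _ _ fun p _ => isHomogeneous_smul ?_ _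
  exact add_comm 1 s ▸ (isHomogeneous_X ℂ p).mul (hf _)

theorem exists_eq_sum_whitney {s k : ℕ} {η : DForm T k} (hη : η ∈ PMinusLam T (s + 1) k) :
    ∃ f : Finset (Fin (n + 1)) → MvPolynomial (Fin (n + 1)) ℂ, (∀ ρ, (f ρ).IsHomogeneous s) ∧
      ∀ x, η x = ∑ ρ ∈ altIndices (k + 1) n, eval (fun i => lam T i x) (f ρ) • whitney T k ρ x := by
  induction hη using Submodule.span_induction with
  | mem η hη =>
    obtain ⟨α, ρ, hα, hρ, rfl⟩ := hη
    refine ⟨fun ρ' => if ρ' = ρ then monomial (Finsupp.equivFunOnFinite.symm α) 1 else 0, ?_, ?_⟩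
    · intro ρ'
      dsimp only
      split_ifs
      · refine isHomogeneous_monomial _ ?_
        rw [Finsupp.degree_eq_sum]
        exact Nat.succ_injective hα
      · exact isHomogeneous_zero _ _ _
    · intro x
      rw [Finset.sum_eq_single_of_mem ρ (Finset.mem_powersetCard_univ.2 hρ)]
      · simp only [if_true]
        rw [eval_monomial, Finsupp.prod_fintype _ _ (fun i => pow_zero _), one_mul]
        rfl
      · intro ρ' _ hρ'
        simp only [hρ', if_false, map_zero, zero_smul]
  | zero => exact ⟨0, fun _ => isHomogeneous_zero _ _ _, fun x => by simp⟩
  | add a b _ _ ha hb =>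
    obtain ⟨f, hf, hf'⟩ := ha
    obtain ⟨g, hg, hg'⟩ := hb
    refine ⟨f + g, fun ρ => (hf ρ).add (hg ρ), fun x => ?_⟩
    simp only [Pi.add_apply, hf', hg', map_add, add_smul, Finset.sum_add_distrib]
  | smul c a _ ha =>
    obtain ⟨f, hf, hf'⟩ := ha
    refine ⟨c • f, fun ρ => isHomogeneous_smul (hf ρ) c, fun x => ?_⟩
    simp only [Pi.smul_apply, hf', eval_const_smul, Finset.smul_sum, smul_smul, smul_eq_mul]

/-- The Whitney form `φ_ρ` is the contraction of `dλ_ρ` with the vector of barycentric coordinates,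
so passing to the `dλ_τ` applies `K` to the coefficients. -/
theorem sum_smul_whitney_eq_sum_altK (k : ℕ)
    (f : Finset (Fin (n + 1)) → ℂ) (x : body T) :
    ∑ ρ ∈ altIndices (k + 1) n, f ρ • whitney T k ρ x
      = ∑ τ ∈ altIndices k n, altK (fun i => lam T i x) f τ • dlam T k τ x := by
  have h1 : ∀ ρ ∈ altIndices (k + 1) n, f ρ • whitney T k ρ x = ∑ p ∈ ρ,
      (eps {p} (ρ.erase p) • (lam T p x * f (insert p (ρ.erase p)))) •
        dlam T k (ρ.erase p) x := by
    intro ρ _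
    rw [whitney, Finset.smul_sum]
    refine Finset.sum_congr rfl fun p hp => ?_
    rw [smul_smul, Finset.insert_erase hp, smul_eq_mul]
    congr 1
    ring
  rw [Finset.sum_congr rfl h1, ← sum_compl_eq_sum_erase k fun τ p =>
    (eps {p} τ • (lam T p x * f (insert p τ))) • dlam T k τ x]
  exact Finset.sum_congr rfl fun τ _ => by rw [altK, Finset.sum_smul]

theorem param_eq_sum (y : refSimplex n) :
    (param T y : E) = ∑ j, refCoord y.1 j • T.points j := by
  simp only [param, refCoord, Fin.sum_univ_succ, Fin.cons_zero, Fin.cons_succ, smul_sub, sub_smul,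
    one_smul, Finset.sum_sub_distrib, Finset.sum_smul]
  abel

theorem param_mem_face {m : ℕ} {fs : Finset (Fin (n + 1))} (h : fs.card = m + 1)
    (y : refSimplex n) (hy : ∀ i, i ∉ fs → refCoord y.1 i = 0) :
    (param T y : E) ∈ body (T.face h) := by
  rw [param_eq_sum, ← Finset.sum_subset (Finset.subset_univ fs)
    fun i _ hi => by rw [hy i hi, zero_smul]]
  refine (convex_convexHull ℝ _).sum_mem (fun i _ => refCoord_nonneg y.2 i) ?_ fun i hi => ?_
  · rw [← sum_refCoord y.1]
    exact Finset.sum_subset (Finset.subset_univ fs) fun i _ hi => hy i hi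
  · refine subset_convexHull ℝ _ ?_
    rw [Affine.Simplex.range_face_points]
    exact ⟨i, hi, rfl⟩

/-- The alternating difference of the coefficients of a form vanishes on a face at the tuples
of vertices of that face if the trace of the form does. -/
theorem altD_eq_zero_of_trace {k m : ℕ} {fs : Finset (Fin (n + 1))} (h : fs.card = m + 1)
    {η : DForm T k} (hη : trace T h η = 0) {x : body T} (hx : (x : E) ∈ body (T.face h))
    {b : Finset (Fin (n + 1)) → ℂ} (hb : η x = ∑ τ ∈ altIndices k n, b τ • dlam T k τ x)
    {θ : Finset (Fin (n + 1))} (hθ : θ.card = k + 1) (hsub : θ ⊆ fs) : altD b θ = 0 := by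
  obtain ⟨a, ha⟩ : θ.Nonempty := Finset.card_pos.1 (by omega)
  have hc : (θ.erase a).card = k := by rw [Finset.card_erase_of_mem ha, hθ]; rfl
  set J := (θ.erase a).orderEmbOfFin hc with hJ
  have hJmem : ∀ l, J l ∈ θ.erase a := fun l => Finset.orderEmbOfFin_mem _ hc l
  have hface : ∀ i ∈ fs, T.points i ∈ affineSpan ℝ (Set.range (T.face h).points) := by
    intro i hi
    refine subset_affineSpan ℝ _ ?_
    rw [Affine.Simplex.range_face_points]
    exact ⟨i, hi, rfl⟩
  have hv : ∀ l, T.points (J l) - T.points a ∈ tangent (T.face h) := fun l =>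
    AffineSubspace.vsub_mem_direction (hface _ (hsub (Finset.mem_of_mem_erase (hJmem l))))
      (hface _ (hsub ha))
  -- The trace is tested on the edges from `a` to the other vertices of `θ`. The differentials
  -- outside `θ` vanish on them and those of `θ - a` give the identity matrix, so the value is `Db`
  -- at `θ` up to sign.
  have h1 := DFunLike.congr_fun (congrFun hη ⟨x, hx⟩) fun l => ⟨_, hv l⟩
  have h2 : η x (fun l => ⟨T.points (J l) - T.points a, points_sub_mem T _ _⟩) = 0 := h1
  rw [hb, alternatingMap_sum_smul_apply] at h2
  simp only [dlam_apply] at h2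
  set M : Fin (n + 1) → Fin k → ℂ := fun p l =>
    dlamOne T p ⟨T.points (J l) - T.points a, points_sub_mem T _ _⟩ with hM
  have hMe : ∀ p l, M p l = (if p = J l then 1 else 0) - (if p = a then 1 else 0) := fun p l =>
    dlamOne_points_sub T p (J l) a
  have hrow : ∀ p, p ∉ θ → M p = 0 := by
    intro p hp
    funext l
    have h3 : p ≠ J l := fun e => hp (e ▸ Finset.mem_of_mem_erase (hJmem l))
    have h4 : p ≠ a := fun e => hp (e ▸ ha)
    rw [hMe, if_neg h3, if_neg h4, sub_zero]
    rfl
  have hdet : minor M (θ.erase a) = 1 := by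
    rw [minor, dif_pos hc, ← Matrix.det_one (n := Fin k)]
    congr 1
    ext i l
    rw [Matrix.of_apply, hMe, if_neg (Finset.ne_of_mem_erase (hJmem i)), sub_zero,
      Matrix.one_apply]
    simp [hJ]
  rw [sum_mul_minor_eq_altD M (sum_rows T k _) hθ hrow ha, hdet, mul_one] at h2
  exact (mul_eq_zero.1 h2).resolve_right (eps_ne_zero _ _)

theorem exists_eq_dualFormOf {r k : ℕ} (hk : k ≤ n) {η : DForm T (n - k)}
    (hη : η ∈ PMinusLamZero T (r + k + 1) (n - k)) :
    ∃ ω, η = dualFormOf T r k ω (n - k) := by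
  obtain ⟨f, hf, hηf⟩ := exists_eq_sum_whitney T hη.1
  set g := altK X f with hg
  have hgh : ∀ τ, (g τ).IsHomogeneous (r + k + 1) := isHomogeneous_altK hf
  have hηg : ∀ x, η x = ∑ τ ∈ altIndices (n - k) n,
      eval (fun i => lam T i x) (g τ) • dlam T (n - k) τ x := by
    intro x
    rw [hηf, sum_smul_whitney_eq_sum_altK]
    simp only [hg, eval_altK]
  have hKg : ∀ μ, altK X g μ = 0 := altK_altK X f
  have hfacet : ∀ τ : Finset (Fin (n + 1)), τ.card = n - k → ∀ i ∈ τᶜ, ∀ t : Fin (n + 1) → ℝ,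
      (∀ j, 0 ≤ t j) → ∑ j, t j = 1 → t i = 0 → eval (fun j => (t j : ℂ)) (g τ) = 0 := by
    intro τ hτ i hi t ht0 ht1 hti
    set y : refSimplex n := ⟨Fin.tail t, tail_mem_refSimplex ht0 ht1⟩ with hy
    have hyt : refCoord y.1 = t := refCoord_tail ht1
    have hlam : (fun j => lam T j (param T y)) = fun j => (t j : ℂ) := by
      funext j
      rw [lam_param, hyt]
    -- The facet opposite vertex `i` has dimension `n - 1`; for `n = 0`, `t i = 0` contradicts `∑ t
    -- = 1`.
    have hn : n ≠ 0 := by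
      rintro rfl
      rw [Fin.sum_univ_one, ← Fin.fin_one_eq_zero i, hti] at ht1
      exact zero_ne_one ht1
    have hcard : (Finset.univ.erase i).card = n - 1 + 1 := by
      rw [Finset.card_erase_of_mem (Finset.mem_univ i), Finset.card_univ, Fintype.card_fin]
      omega
    have htr := hη.2 (n - 1) (Finset.univ.erase i) hcard
      (fun e => (Finset.erase_eq_self.1 e) (Finset.mem_univ i))
    have hx : (param T y : E) ∈ body (T.face hcard) := param_mem_face T hcard y fun j hj => by
      have : j = i := by simpa using hj
      rw [this, hyt, hti]
    set b : Finset (Fin (n + 1)) → ℂ := fun σ => eval (fun j => (t j : ℂ)) (g σ) with hb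
    have hD : ∀ θ : Finset (Fin (n + 1)), θ.card = n - k + 1 → i ∉ θ → altD b θ = 0 := by
      intro θ hθ hiθ
      refine altD_eq_zero_of_trace T hcard htr hx (b := b) ?_ hθ fun j hj =>
        Finset.mem_erase.2 ⟨fun e => hiθ (e ▸ hj), Finset.mem_univ j⟩
      rw [hηg, hlam]
    have hK : ∀ μ, altK (fun j => (t j : ℂ)) b μ = 0 := by
      intro μ
      rw [hb, ← eval_altK, hKg, map_zero]
    -- Since `Kb = 0` and `∑ t = 1`, the homotopy formula reads `b τ = (K D b) τ`. The term
    -- inserting `i` carries `t i = 0`; every other one evaluates `Db` at a tuple avoiding `i`,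
    -- where the zero trace on the facet applies.
    have h1 := altK_altD_add_altD_altK (fun j => (t j : ℂ)) b τ
    have h2 : altD (altK (fun j => (t j : ℂ)) b) τ = 0 :=
      Finset.sum_eq_zero fun p _ => by rw [hK, smul_zero]
    have h3 : altK (fun j => (t j : ℂ)) (altD b) τ = 0 := by
      refine Finset.sum_eq_zero fun p hp => ?_
      rcases eq_or_ne p i with rfl | hpi
      · simp only [hti, Complex.ofReal_zero, zero_mul, smul_zero]
      · rw [Finset.mem_compl] at hp hi
        rw [hD, mul_zero, smul_zero]
        · rw [Finset.card_insert_of_notMem hp, hτ]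
        · rw [Finset.mem_insert, not_or]
          exact ⟨hpi.symm, hi⟩
    rw [h2, h3, add_zero, ← Complex.ofReal_sum, ht1, Complex.ofReal_one, one_mul] at h1
    exact h1.symm
  have hdiv : ∀ τ : Finset (Fin (n + 1)), ∃ q : MvPolynomial (Fin (n + 1)) ℂ,
      q.IsHomogeneous r ∧ (τ.card = n - k → g τ = (∏ i ∈ τᶜ, X i) * q) := by
    intro τ
    by_cases hτ : τ.card = n - k
    · have hc : τᶜ.card = k + 1 := by
        rw [Finset.card_compl, Fintype.card_fin, hτ]; omega
      have hdeg : τᶜ.card + r = r + k + 1 := by omega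
      obtain ⟨q, hq, hq'⟩ := exists_eq_prod_X_mul (by omega) (hdeg ▸ hgh τ) (hfacet τ hτ)
      exact ⟨q, hq, fun _ => hq'⟩
    · exact ⟨0, isHomogeneous_zero _ _ _, fun h => absurd h hτ⟩
  choose h hhom hgh' using hdiv
  have hcocycle : ∀ μ : Finset (Fin (n + 1)), μ.card + (k + 1) = n →
      ∑ p ∈ μᶜ, eps {p} μ • h (insert p μ) = 0 := by
    intro μ hμ
    -- The factor `X p` in `K` completes the product over the complement of `μ + p` to the product
    -- over `μᶜ`. This common nonzero factor is then cancelled from `Kg = 0`.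
    have h1 : (∏ i ∈ μᶜ, X i) * ∑ p ∈ μᶜ, eps {p} μ • h (insert p μ) = 0 := by
      rw [← hKg μ, altK, Finset.mul_sum]
      refine Finset.sum_congr rfl fun p hp => ?_
      rw [hgh' (insert p μ) (by rw [Finset.card_insert_of_notMem (Finset.mem_compl.1 hp)]; omega),
        Finset.compl_insert, ← Finset.mul_prod_erase _ _ hp, mul_smul_comm, mul_assoc]
    exact (mul_eq_zero.1 h1).resolve_left (Finset.prod_ne_zero_iff.2 fun i _ => X_ne_zero i)
  set c : Finset (Fin (n + 1)) → MvPolynomial (Fin (n + 1)) ℂ := fun σ =>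
    if 0 ∈ σ then 0 else eps (insert 0 σ) (insert 0 σ)ᶜ • h (insert 0 σ)ᶜ with hc
  have hchom : ∀ σ, (c σ).IsHomogeneous r := by
    intro σ
    rw [hc]
    dsimp only
    split_ifs
    · exact isHomogeneous_zero _ _ _
    · exact isHomogeneous_smul (hhom _) _
  have hcD : ∀ θ : Finset (Fin (n + 1)), θ.card = k + 1 → altD c θ = eps θ θᶜ • h θᶜ :=
    altD_cone k h hcocycle
  -- The factor `(-1) ^ k` compensates the one in `sum_whitney_compl`.
  refine ⟨fun α σ => (-1) ^ k * coeff (Finsupp.equivFunOnFinite.symm α) (c σ), ?_⟩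
  funext x
  have hce : coefEval r (fun α σ => (-1) ^ k * coeff (Finsupp.equivFunOnFinite.symm α) (c σ))
      (fun i => lam T i x) = fun σ => (-1) ^ k * eval (fun i => lam T i x) (c σ) := by
    funext σ
    conv_rhs => rw [← coefPoly_coeff (hchom σ)]
    rw [coefEval, eval_coefPoly, eval_coefPoly, Finset.mul_sum]
    exact Finset.sum_congr rfl fun α _ => by ring
  rw [dualFormOf, sum_smul_whitney_eq, sum_whitney_compl, hηg,
    sum_powersetCard_compl (k := k + 1) (by omega), hce]
  refine Finset.sum_congr rfl fun θ hθ => ?_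
  rw [Finset.mem_powersetCard_univ] at hθ
  have hθc : θᶜ.card = n - k := by
    rw [Finset.card_compl, Fintype.card_fin, hθ]; omega
  have hd : altD (fun σ => (-1) ^ k * eval (fun i => lam T i x) (c σ)) θ
      = (-1) ^ k * (eps θ θᶜ * eval (fun i => lam T i x) (h θᶜ)) := by
    have h1 := congrArg (eval fun i => lam T i x) (hcD θ hθ)
    rw [eval_altD, eval_const_smul, smul_eq_mul] at h1
    rw [← h1, altD, altD, Finset.mul_sum]
    exact Finset.sum_congr rfl fun p _ => by rw [smul_eq_mul, smul_eq_mul]; ring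
  rw [hd, hgh' θᶜ hθc, compl_compl, map_mul, map_prod, lamProd]
  simp only [eval_X]
  congr 1
  have hsq : ((-1 : ℂ) ^ k) * (-1) ^ k = 1 := by rw [← mul_pow]; simp
  linear_combination -((∏ i ∈ θ, lam T i x) * eval (fun i => lam T i x) (h θᶜ)) *
    (eps θ θᶜ * eps θ θᶜ * hsq + eps_mul_self θ θᶜ)

end Spanning

/-! ### The integration pairing and its non-degeneracy -/

section Nondegenerate

variable {E : Type*} [NormedAddCommGroup E] [InnerProductSpace ℝ E] {n : ℕ}
  (T : Affine.Simplex ℝ E n)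

/-- The integration pairing. -/
def pairing (r k : ℕ) (hk : k ≤ n) :
    PLam T r k →ₗ[ℂ] PMinusLamZero T (r + k + 1) (n - k) →ₗ[ℂ] ℂ :=
  LinearMap.mk₂ ℂ
    (fun ω η => integral T (Nat.add_sub_of_le hk) (DForm.wedge ω.1 η.1))
    (fun a b η => by
      rw [← integral_add _ (wedge_mem_contForms (PLam_le_contForms _ _ a.2)
        (PMinusLam_le_contForms _ _ η.2.1)) (wedge_mem_contForms (PLam_le_contForms _ _ b.2)
        (PMinusLam_le_contForms _ _ η.2.1))]
      congr 1
      funext x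
      simp only [DForm.wedge, ← wedgeBilin_apply, Submodule.coe_add, Pi.add_apply, map_add,
        LinearMap.add_apply])
    (fun c a η => by
      rw [smul_eq_mul, ← integral_smul]
      congr 1
      funext x
      simp only [DForm.wedge, ← wedgeBilin_apply, Submodule.coe_smul, Pi.smul_apply, map_smul,
        LinearMap.smul_apply])
    (fun a η ζ => by
      rw [← integral_add _ (wedge_mem_contForms (PLam_le_contForms _ _ a.2)
        (PMinusLam_le_contForms _ _ η.2.1)) (wedge_mem_contForms (PLam_le_contForms _ _ a.2)
        (PMinusLam_le_contForms _ _ ζ.2.1))]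
      congr 1
      funext x
      simp only [DForm.wedge, ← wedgeBilin_apply, Submodule.coe_add, Pi.add_apply, map_add])
    (fun c a η => by
      rw [smul_eq_mul, ← integral_smul]
      congr 1
      funext x
      simp only [DForm.wedge, ← wedgeBilin_apply, Submodule.coe_smul, Pi.smul_apply, map_smul])

theorem pairing_apply (r k : ℕ) (hk : k ≤ n) (ω : PLam T r k)
    (η : PMinusLamZero T (r + k + 1) (n - k)) :
    pairing T r k hk ω η = integral T (Nat.add_sub_of_le hk) (DForm.wedge ω.1 η.1) := rfl

/-- Either element is tested against its partner with conjugate coefficients, which makes the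
pairing a `pairingSum`. Its vanishing makes the coefficients `D`-closed, and then both the form and
the dual form are zero. -/
theorem pairing_nondegenerate (r k : ℕ) (hk : k ≤ n) : (pairing T r k hk).Nondegenerate := by
  constructor
  · rintro ⟨a, ha⟩ h
    obtain ⟨ω, rfl⟩ := exists_eq_formOf T ha
    have h1 := h ⟨_, dualFormOf_mem T hk fun α σ => conj (ω α σ)⟩
    rw [pairing_apply, ← pairingSum_eq_integral T r k ω hk] at h1
    exact Subtype.ext (formOf_eq_zero T r k ω (altD_eq_zero_of_pairingSum T r k ω hk h1))
  · rintro ⟨η, hη⟩ h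
    obtain ⟨ω, rfl⟩ := exists_eq_dualFormOf T hk hη
    have h1 := h ⟨_, formOf_mem T r k fun α σ => conj (ω α σ)⟩
    have hω : ω = fun α σ => conj (conj (ω α σ)) := by simp only [Complex.conj_conj]
    have h2 : pairingSum T r k hk (fun α σ => conj (ω α σ)) = 0 := by
      rw [pairingSum_eq_integral, ← h1, pairing_apply, ← hω]
    have h3 := altD_eq_zero_of_pairingSum T r k _ hk h2
    refine Subtype.ext (dualFormOf_eq_zero T r k ω _ fun α hα θ hθ => ?_)
    have h4 := h3 α hα θ hθ
    rwa [altD_conj, map_eq_zero] at h4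

end Nondegenerate

end BaryForms

end


theorem mainTheorem6 {E : Type*} [NormedAddCommGroup E] [InnerProductSpace ℝ E] {n : ℕ}
    (T : Affine.Simplex ℝ E n) (r k : ℕ) (hk : k ≤ n) :
    (∀ ω : (Fin (n + 1) → ℕ) → Finset (Fin (n + 1)) → ℂ,
      pairingSum T r k hk ω
        = (-1) ^ k * ∑ θ ∈ altIndices (k + 1) n, integral T rfl (fun x =>
            (lamProd T θ x * (‖∑ α ∈ multiIndices r n, ∑ p ∈ θ,
              eps {p} (θ.erase p) * lamPow T α x * ω α (θ.erase p)‖ ^ 2 : ℝ)) • whitneyTop T x) ∧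
      List.TFAE [
        pairingSum T r k hk ω = 0,
        (fun x => ∑ α ∈ multiIndices r n, ∑ σ ∈ altIndices k n,
          (ω α σ * lamPow T α x) • dlam T k σ x) = (0 : DForm T k),
        (fun x => ∑ α ∈ multiIndices r n, ∑ σ ∈ altIndices k n,
          (eps σ σᶜ * ω α σ * lamPow T α x * lamProd T σ x) • whitney T (n - k) σᶜ x)
            = (0 : DForm T (n - k)),
        ∀ α ∈ multiIndices r n, ∀ σ ∈ altIndices k n, 0 ∉ σ →
          ω α σ - ∑ p ∈ σ, eps {p} (σ.erase p) * ω α (insert 0 (σ.erase p)) = 0,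
        ∀ α ∈ multiIndices r n, ∀ θ ∈ altIndices (k + 1) n,
          ∑ p ∈ θ, eps {p} (θ.erase p) * ω α (θ.erase p) = 0]) ∧
    ∃ B : PLam T r k →ₗ[ℂ] PMinusLamZero T (r + k + 1) (n - k) →ₗ[ℂ] ℂ,
      (∀ ω η, B ω η = integral T (Nat.add_sub_of_le hk) (DForm.wedge ω.1 η.1)) ∧
      B.Nondegenerate := by
  refine ⟨fun ω => ⟨?_, tfae_pairing T r k ω hk⟩,
    pairing T r k hk, pairing_apply T r k hk, pairing_nondegenerate T r k hk⟩
  rw [sum_integral_whitneyTop, pairingSum_eq_integral, integral_wedge_formOf_dualFormOf]
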